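/- Let $A\le\tilde A$ be abelian groups, let $V$ be a strongly $A$-graded M\"obius or conformal vertex algebra (so $V=\coprod_{n\in\mathbb Z,\alpha\in A}V_{(n)}^{(\alpha)}$ with finite-dimensional $V_{(n)}^{(\alpha)}$, zero for $n$ sufficiently negative), and let $z\in\mathbb C^\times$. A strongly $\tilde A$-graded generalized $V$-module is a module $W=\coprod_{n\in\mathbb C,\beta\in\tilde A}W_{[n]}^{(\beta)}$ for $V$ (and for $\mathfrak{sl}(2)$, through $L(-1),L(0),L(1)$, given by the conformal vector if $V$ is conformal), compatible with the $\tilde A$-grading, such that $L(0)-n$ acts locally nilpotently on $W_{[n]}$, each $W_{[n]}^{(\beta)}$ is finite-dimensional, and $W_{[n+k]}^{(\beta)}=0$ for $k\in\mathbb Z$ sufficiently negative; it is an ordinary module if $L(0)$ acts on each $W_{[n]}$ as the scalar $n$. Let $\mathcal{GM}_{sg}$ be the category of strongly $\tilde A$-graded generalized $V$-modules, $\mathcal M_{sg}$ its full subcategory of ordinary modules, and $\mathcal C$ a full subcategory of $\mathcal{GM}_{sg}$ closed under contragredients and finite direct sums. Write $W'=\coprod (W_{[n]}^{(\beta)})^*$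 and $\overline W=\prod W_{[n]}^{(\beta)}$. Let $W_1,W_2\in\mathcal C$. A $P(z)$-intertwining map $I:W_1\otimes W_2\to\overline W$ is a linear map compatible with the $\tilde A$-gradings, satisfying lower truncation (for all $w_1,w_2$ and $n\in\mathbb C$, the component of $I(w_1\otimes w_2)$ of weight $n-m$ vanishes for $m\in\mathbb N$ sufficiently large), the Jacobi identity $$x_0^{-1}\delta\Big(\tfrac{x_1-z}{x_0}\Big)Y(v,x_1)I(w_1\otimes w_2)=z^{-1}\delta\Big(\tfrac{x_1-x_0}{z}\Big)I(Y_1(v,x_0)w_1\otimes w_2)+x_0^{-1}\delta\Big(\tfrac{z-x_1}{-x_0}\Big)I(w_1\otimes Y_2(v,x_1)w_2)$$ and $L(j)I(w_1\otimes w_2)=I(w_1\otimes L(j)w_2)+\sum_{i=0}^{j+1}\binom{j+1}{i}z^iI(L(j-i)w_1\otimes w_2)$ for $j=-1,0,1$. Let $W_1\,\backslash\!\!\!\boxtimes_{P(z)}W_2\subset(W_1\otimes W_2)^*$ be the set of all functionals $w'\circ I$ with $W\in\mathcal C$, $I:W_1\otimes W_2\to\overline W$ a $P(z)$-intertwining map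 and $w'\in W'$. Let $\tau_{P(z)}$ be the action of $V\otimes\iota_+\mathbb C[t,t^{-1},(z^{-1}-t)^{-1}]$ on $(W_1\otimes W_2)^*$ given, with $Y_t(v,x)=\sum_{n\in\mathbb Z}(v\otimes t^n)x^{-n-1}$ and $Y_2^o(v,x)=Y_2(e^{xL(1)}(-x^{-2})^{L(0)}v,x^{-1})$, by $$\Big(\tau_{P(z)}\Big(x_0^{-1}\delta\Big(\tfrac{x_1^{-1}-z}{x_0}\Big)Y_t(v,x_1)\Big)\lambda\Big)(w_1\otimes w_2)=z^{-1}\delta\Big(\tfrac{x_1^{-1}-x_0}{z}\Big)\lambda(Y_1(e^{x_1L(1)}(-x_1^{-2})^{L(0)}v,x_0)w_1\otimes w_2)+x_0^{-1}\delta\Big(\tfrac{z-x_1^{-1}}{-x_0}\Big)\lambda(w_1\otimes Y_2^o(v,x_1)w_2),$$ put $Y'_{P(z)}(v,x)=\tau_{P(z)}(Y_t(v,x))$, and for $j=-1,0,1$ let $$(L'_{P(z)}(j)\lambda)(w_1\otimes w_2)=\lambda\Big(w_1\otimes L(-j)w_2+\sum_{i=0}^{1-j}\tbinom{1-j}{i}z^iL(-j-i)w_1\otimes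 w_2\Big).$$ Let $((W_1\otimes W_2)^*)^{(\beta)}$ be the space of functionals vanishing on $(W_1\otimes W_2)^{(\gamma)}$ for $\gamma\ne-\beta$, and $((W_1\otimes W_2)^*)_{[n]}^{(\beta)}$, $((W_1\otimes W_2)^*)_{(n)}^{(\beta)}$ its subspaces of generalized eigenvectors, respectively eigenvectors, of $L'_{P(z)}(0)$ of eigenvalue $n$. Let $\mathrm{COMP}_{P(z)}$ be the set of $\lambda\in(W_1\otimes W_2)^*$ such that, for all $v\in V$, $Y'_{P(z)}(v,x)\lambda$ involves only finitely many negative powers of $x$ and $$\tau_{P(z)}\Big(x_0^{-1}\delta\Big(\tfrac{x_1^{-1}-z}{x_0}\Big)Y_t(v,x_1)\Big)\lambda=x_0^{-1}\delta\Big(\tfrac{x_1^{-1}-z}{x_0}\Big)Y'_{P(z)}(v,x_1)\lambda .$$ For $\lambda\in\coprod_{n,\beta}((W_1\otimes W_2)^*)_{[n]}^{(\beta)}$ let $W_\lambda$ be the smallest doubly graded subspace of this space that contains $\lambda$ and is stable under the components of all $Y'_{P(z)}(v,x)$ and under $L'_{P(z)}(j)$, $j=-1,0,1$. Let $\mathrm{LGR}_{[\mathbb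 C];P(z)}$ be the set of such $\lambda$ for which, for all $n\in\mathbb C$ and $\beta\in\tilde A$, $(W_\lambda)_{[n]}^{(\beta)}$ is finite-dimensional and $(W_\lambda)_{[n+k]}^{(\beta)}=0$ for $k\in\mathbb Z$ sufficiently negative; $\mathrm{LGR}_{(\mathbb C);P(z)}$ is defined in the same way with the eigenspaces $((W_1\otimes W_2)^*)_{(n)}^{(\beta)}$ in place of the generalized ones. An object of $\mathcal C$ included in $(W_1\otimes W_2)^*$ is an object $M$ of $\mathcal C$ with an injective linear map $M\to(W_1\otimes W_2)^*$ that preserves the $\tilde A$-gradings and intertwines the actions of $V\otimes\iota_+\mathbb C[t,t^{-1},(z^{-1}-t)^{-1}]$ (by $\tau_{P(z)}$ on $(W_1\otimes W_2)^*$, by $v\otimes t^n\mapsto v_n$ on $M$) and of $\mathfrak{sl}(2)$ (by the $L'_{P(z)}(j)$ on $(W_1\otimes W_2)^*$). (1) Suppose that for every $\lambda\in\mathrm{COMP}_{P(z)}\cap\mathrm{LGR}_{[\mathbb C];P(z)}$ the space $W_\lambda$ is contained in some object of $\mathcal C$ included in $(W_1\otimes W_2)^*$. Then $$W_1\,\backslash\!\!\!\boxtimes_{P(z)}W_2=\mathrm{COMP}_{P(z)}\cap\mathrm{LGR}_{[\mathbb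 C];P(z)}.$$ (2) Suppose that $\mathcal C\subset\mathcal M_{sg}$ and that for every $\lambda\in\mathrm{COMP}_{P(z)}\cap\mathrm{LGR}_{(\mathbb C);P(z)}$ the space $W_\lambda$ is contained in some object of $\mathcal C$ included in $(W_1\otimes W_2)^*$. Then $$W_1\,\backslash\!\!\!\boxtimes_{P(z)}W_2=\mathrm{COMP}_{P(z)}\cap\mathrm{LGR}_{(\mathbb C);P(z)}.$$ -/

import Mathlib

open scoped TensorProduct

universe u v w

noncomputable section

namespace HLZ

/-! ### Gradings -/

section Gradings

variable {ι : Type*} {M : Type*} [AddCommGroup M] [Module ℂ M]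

open scoped Classical in
/-- `M` is the direct sum of the subspaces `G i`. -/
def IsGrading (G : ι → Submodule ℂ M) : Prop := DirectSum.IsInternal G

open scoped Classical in
/-- The projection of a graded space to its component of degree `i`. -/
def IsGrading.proj {G : ι → Submodule ℂ M} (h : IsGrading G) (i : ι) : M →ₗ[ℂ] G i :=
  DirectSum.component ℂ ι (fun i => G i) i ∘ₗ
    ((LinearEquiv.ofBijective (DirectSum.coeLinearMap G) h).symm : M →ₗ[ℂ] _)

end Gradings

/-- The integer binomial coefficient `k (k-1) ⋯ (k-i+1) / i!`, for `k ∈ ℤ`, as a complex number. -/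
def binom (k : ℤ) (i : ℕ) : ℂ := ((Ring.choose k i : ℤ) : ℂ)

/-! ### Conformal and Möbius vertex algebras

Throughout, a vertex operator `Y(v, x) = ∑ v_n x^{-n-1}` is given by its components
`Y n v = v_n`, and `L j`, for `j = -1, 0, 1` in `SignType`, are the operators `L(j)` giving
the action of `𝔰𝔩(2)`. -/

/-- The axioms, other than those about gradings, for vertex operators on `W` parametrized by a
vertex algebra `(V, Y₀, one)` with `𝔰𝔩(2)`-operators `L₀`, together with
`𝔰𝔩(2)`-operators `L` on `W`. -/
structure IsVertexAction {V : Type v} [AddCommGroup V] [Module ℂ V]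
    {W : Type u} [AddCommGroup W] [Module ℂ W]
    (Y₀ : ℤ → V →ₗ[ℂ] V →ₗ[ℂ] V) (one : V) (L₀ : SignType → Module.End ℂ V)
    (Y : ℤ → V →ₗ[ℂ] W →ₗ[ℂ] W) (L : SignType → Module.End ℂ W) : Prop where
  /-- Lower truncation: `v_n w = 0` for `n` sufficiently large. -/
  truncation : ∀ (v : V) (w : W), ∃ N : ℤ, ∀ n : ℤ, N ≤ n → Y n v w = 0
  /-- `Y(1, x) = 1`. -/
  vacuum : ∀ (n : ℤ) (w : W), Y n one w = if n = -1 then w else 0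
  /-- The Jacobi identity: the coefficient of `x₀^{-r-1} x₁^{-p-1} x₂^{-q-1}` in
  `x₀⁻¹δ((x₁-x₂)/x₀) Y(a,x₁)Y(b,x₂) - x₀⁻¹δ((x₂-x₁)/(-x₀)) Y(b,x₂)Y(a,x₁)
    = x₂⁻¹δ((x₁-x₀)/x₂) Y(Y(a,x₀)b,x₂)`. -/
  jacobi : ∀ (a b : V) (w : W) (p q r : ℤ),
    (∑ᶠ i : ℕ, ((-1 : ℂ) ^ i * binom r i) •
      (Y (p + r - i) a (Y (q + i) b w) - (-1 : ℂ) ^ r • Y (q + r - i) b (Y (p + i) a w)))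
    = ∑ᶠ i : ℕ, binom p i • Y (p + q - i) (Y₀ (r + i) a b) w
  /-- The `L(-1)`-derivative property `d/dx Y(v, x) = Y(L(-1)v, x)`. -/
  deriv : ∀ (n : ℤ) (v : V), Y n (L₀ (-1) v) = (-(n : ℂ)) • Y (n - 1) v
  bracket_zero_neg : L 0 * L (-1) - L (-1) * L 0 = L (-1)
  bracket_zero_pos : L 0 * L 1 - L 1 * L 0 = -L 1
  bracket_pos_neg : L 1 * L (-1) - L (-1) * L 1 = (2 : ℂ) • L 0
  /-- `[L(-1), Y(v, x)] = Y(L(-1)v, x)`. -/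
  comm_neg : ∀ (n : ℤ) (v : V) (w : W),
    L (-1) (Y n v w) - Y n v (L (-1) w) = Y n (L₀ (-1) v) w
  /-- `[L(0), Y(v, x)] = Y(L(0)v, x) + x Y(L(-1)v, x)`. -/
  comm_zero : ∀ (n : ℤ) (v : V) (w : W),
    L 0 (Y n v w) - Y n v (L 0 w) = Y n (L₀ 0 v) w + Y (n + 1) (L₀ (-1) v) w
  /-- `[L(1), Y(v, x)] = Y(L(1)v, x) + 2 x Y(L(0)v, x) + x² Y(L(-1)v, x)`. -/
  comm_pos : ∀ (n : ℤ) (v : V) (w : W),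
    L 1 (Y n v w) - Y n v (L 1 w)
      = Y n (L₀ 1 v) w + (2 : ℂ) • Y (n + 1) (L₀ 0 v) w + Y (n + 2) (L₀ (-1) v) w

/-- A strongly `A`-graded Möbius vertex algebra (`omega = none`) or conformal vertex algebra
(`omega = some ω`, with conformal vector `ω`) on the complex vector space `V`.
`grade n α` is the doubly homogeneous subspace `V_(n)^(α)`. -/
structure VertexAlgebra {Γ : Type w} [AddCommGroup Γ] (A : AddSubgroup Γ)
    (V : Type v) [AddCommGroup V] [Module ℂ V] where
  Y : ℤ → V →ₗ[ℂ] V →ₗ[ℂ] V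
  one : V
  L : SignType → Module.End ℂ V
  omega : Option V
  grade : ℤ → A → Submodule ℂ V
  action : IsVertexAction Y one L Y L
  /-- Creation property: `Y(v, x)1 ∈ V[[x]]` with constant term `v`. -/
  creation : ∀ (v : V) (n : ℤ), 0 ≤ n → Y n v one = 0
  creation_const : ∀ v : V, Y (-1) v one = v
  isGrading : IsGrading fun i : ℤ × A => grade i.1 i.2
  L_zero : ∀ (n : ℤ) (α : A), ∀ v ∈ grade n α, L 0 v = (n : ℂ) • v
  grading_restriction : ∀ α : A, ∃ N : ℤ, ∀ n : ℤ, n ≤ N → grade n α = ⊥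
  finite_dim : ∀ (n : ℤ) (α : A), FiniteDimensional ℂ (grade n α)
  one_mem : one ∈ grade 0 0
  Y_mem : ∀ (α β : A) (l : ℤ), ∀ v ∈ ⨆ h, grade h α, ∀ x ∈ ⨆ h, grade h β,
    Y l v x ∈ ⨆ h, grade h (α + β)
  L_mem : ∀ (j : SignType) (α : A), ∀ v ∈ ⨆ h, grade h α, L j v ∈ ⨆ h, grade h α
  omega_mem : ∀ ω ∈ omega, ω ∈ grade 2 0
  L_eq_omega : ∀ ω ∈ omega, ∀ j : SignType, L j = Y ((j : ℤ) + 1) ω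
  /-- The Virasoro relations for `L(n) = ω_{n+1}`, with a central charge `c`. -/
  virasoro : ∀ ω ∈ omega, ∃ c : ℂ, ∀ m n : ℤ,
    Y (m + 1) ω * Y (n + 1) ω - Y (n + 1) ω * Y (m + 1) ω
      = ((m : ℂ) - n) • Y (m + n + 1) ω
        + (if m + n = 0 then ((m : ℂ) ^ 3 - m) / 12 * c else 0) • (1 : Module.End ℂ V)

section Setting

variable {Γ : Type w} [AddCommGroup Γ] {A : AddSubgroup Γ}
  {V : Type v} [AddCommGroup V] [Module ℂ V]

/-- A strongly `Γ`-graded generalized `V`-module, where the abelian group `Γ` contains `A`.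
`grade n β` is the doubly homogeneous subspace `W_[n]^(β)`. When `V` is conformal, the operators
`L(-1), L(0), L(1)` are those given by the conformal vector. -/
structure GenModule (𝒱 : VertexAlgebra A V) where
  carrier : Type u
  [addCommGroup : AddCommGroup carrier]
  [module : Module ℂ carrier]
  Y : ℤ → V →ₗ[ℂ] carrier →ₗ[ℂ] carrier
  L : SignType → Module.End ℂ carrier
  grade : ℂ → Γ → Submodule ℂ carrier
  action : IsVertexAction 𝒱.Y 𝒱.one 𝒱.L Y L
  L_eq_omega : ∀ ω ∈ 𝒱.omega, ∀ j : SignType, L j = Y ((j : ℤ) + 1) ω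
  isGrading : IsGrading fun i : ℂ × Γ => grade i.1 i.2
  L_zero : ∀ (n : ℂ) (β : Γ), ∀ x ∈ grade n β, ∃ m : ℕ,
    ((L 0 - n • (1 : Module.End ℂ carrier)) ^ m) x = 0
  grading_restriction : ∀ (n : ℂ) (β : Γ), ∃ K : ℤ, ∀ k : ℤ, k ≤ K → grade (n + k) β = ⊥
  finite_dim : ∀ (n : ℂ) (β : Γ), FiniteDimensional ℂ (grade n β)
  Y_mem : ∀ (α : A) (β : Γ) (l : ℤ), ∀ v ∈ ⨆ h, 𝒱.grade h α, ∀ x ∈ ⨆ n, grade n β,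
    Y l v x ∈ ⨆ n, grade n ((α : Γ) + β)
  L_mem : ∀ (j : SignType) (β : Γ), ∀ x ∈ ⨆ n, grade n β, L j x ∈ ⨆ n, grade n β

attribute [instance] GenModule.addCommGroup GenModule.module

variable {𝒱 : VertexAlgebra A V}

instance : CoeSort (GenModule.{u} 𝒱) (Type u) := ⟨GenModule.carrier⟩

/-- A generalized module is an (ordinary) module if `L(0)` acts on `W_[n]` as the scalar `n`. -/
def GenModule.IsOrdinary (W : GenModule.{u} 𝒱) : Prop :=
  ∀ (n : ℂ) (β : Γ), ∀ x ∈ W.grade n β, W.L 0 x = n • x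

/-- The `Γ`-homogeneous subspace `W^(β)`. -/
def GenModule.gammaGrade (W : GenModule.{u} 𝒱) (β : Γ) : Submodule ℂ W := ⨆ n, W.grade n β

/-! ### Series of components and the opposite-operator map -/

/-- The action `τ_W (v ⊗ ∑_{i ≥ 0} a_i t^{N+i}) = ∑_{i ≥ 0} a_i v_{N+i}` of `V ⊗ ℂ((t))`
on a generalized module. -/
def GenModule.actSeries (W : GenModule.{u} 𝒱) (a : ℕ → ℂ) (N : ℤ) (v : V) :
    Module.End ℂ W :=
  have fin : ∀ x : W, (Function.support fun i : ℕ => a i • W.Y (N + i) v x).Finite := by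
    intro x
    obtain ⟨K, hK⟩ := W.action.truncation v x
    refine (Set.finite_lt_nat (K - N).toNat).subset fun i hi => ?_
    by_contra hlt
    refine hi ?_
    have h : K ≤ N + i := by
      have : ¬ i < (K - N).toNat := hlt
      omega
    simp [hK _ h]
  { toFun := fun x => ∑ᶠ i : ℕ, a i • W.Y (N + i) v x
    map_add' := by
      intro x y
      rw [← finsum_add_distrib (fin x) (fin y)]
      simp
    map_smul' := by
      intro c x
      rw [RingHom.id_apply, smul_finsum' c (fin x)]
      refine finsum_congr fun i => ?_
      rw [map_smul, smul_comm] }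

/-- For linear maps `Φ k : V → U`, written as `Z(v, x) = ∑ (Φ n v) x^{-n-1}`, the component
of index `n` of the opposite series `Z°(v, x) = Z(e^{xL(1)} (-x⁻²)^{L(0)} v, x⁻¹)`; for `v` of
weight `h` it is `(-1)^h ∑_m (1/m!) Φ (2h-m-2-n) (L(1)^m v)`. -/
def VertexAlgebra.opp (𝒱 : VertexAlgebra A V) {U : Type*} [AddCommGroup U] [Module ℂ U]
    (Φ : ℤ → V → U) (n : ℤ) (v : V) : U :=
  ∑ᶠ s : (ℤ × A) × ℕ, ((-1 : ℂ) ^ s.1.1 / (s.2.factorial : ℂ)) •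
    Φ (2 * s.1.1 - s.2 - 2 - n) ((𝒱.L 1 ^ s.2) (𝒱.isGrading.proj s.1 v : V))

/-! ### Contragredient modules, finite direct sums -/

/-- The component `(W')_[n]^(β) = (W_[n]^(-β))*` of the contragredient, in the full dual. -/
def GenModule.dualGrade (W : GenModule.{u} 𝒱) (n : ℂ) (β : Γ) :
    Submodule ℂ (Module.Dual ℂ W) where
  carrier := {f | ∀ (m : ℂ) (γ : Γ), (m, γ) ≠ (n, -β) → ∀ x ∈ W.grade m γ, f x = 0}
  add_mem' := by
    intro f g hf hg m γ h x hx
    simp [hf m γ h x hx, hg m γ h x hx]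
  zero_mem' := by
    intro m γ _ x _
    rfl
  smul_mem' := by
    intro c f hf m γ h x hx
    simp [hf m γ h x hx]

/-- The graded dual `W' = ∐ (W_[n]^(β))*`, the underlying space of the contragredient. -/
def GenModule.gradedDual (W : GenModule.{u} 𝒱) : Submodule ℂ (Module.Dual ℂ W) :=
  ⨆ i : ℂ × Γ, W.dualGrade i.1 i.2

/-- `N` is (isomorphic to) the contragredient module `W'` of `W`, with
`⟨Y'(v, x) w', w⟩ = ⟨w', Y°(v, x) w⟩` and `⟨L'(j) w', w⟩ = ⟨w', L(-j) w⟩`. -/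
def IsContragredient (W N : GenModule.{u} 𝒱) : Prop :=
  ∃ φ : N ≃ₗ[ℂ] W.gradedDual,
    (∀ (n : ℤ) (v : V) (y : N) (x : W),
      (φ (N.Y n v y) : Module.Dual ℂ W) x
        = (φ y : Module.Dual ℂ W) (𝒱.opp (fun k a => W.Y k a) n v x)) ∧
    (∀ (j : SignType) (y : N) (x : W),
      (φ (N.L j y) : Module.Dual ℂ W) x = (φ y : Module.Dual ℂ W) (W.L (-j) x)) ∧
    (∀ (n : ℂ) (β : Γ) (y : N),
      y ∈ N.grade n β ↔ (φ y : Module.Dual ℂ W) ∈ W.dualGrade n β)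

/-- `S` is (isomorphic to) the direct sum of `W` and `W'`. -/
def IsDirectSum (W W' S : GenModule.{u} 𝒱) : Prop :=
  ∃ φ : S ≃ₗ[ℂ] W × W',
    (∀ (n : ℤ) (v : V) (s : S), φ (S.Y n v s) = (W.Y n v (φ s).1, W'.Y n v (φ s).2)) ∧
    (∀ (j : SignType) (s : S), φ (S.L j s) = (W.L j (φ s).1, W'.L j (φ s).2)) ∧
    (∀ (n : ℂ) (β : Γ) (s : S),
      s ∈ S.grade n β ↔ (φ s).1 ∈ W.grade n β ∧ (φ s).2 ∈ W'.grade n β)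

/-- The class of objects `C` is closed under the contragredient functor. -/
def ClosedUnderContragredients (C : GenModule.{u} 𝒱 → Prop) : Prop :=
  ∀ W, C W → ∃ N, C N ∧ IsContragredient W N

/-- The class of objects `C` is closed under finite direct sums. -/
def ClosedUnderDirectSums (C : GenModule.{u} 𝒱 → Prop) : Prop :=
  ∀ W W', C W → C W' → ∃ S, C S ∧ IsDirectSum W W' S

/-! ### `P(z)`-intertwining maps -/

/-- The formal completion `∏ W_[n]^(β)` of a generalized module. -/
abbrev GenModule.Completion (W : GenModule.{u} 𝒱) : Type (max u w) :=
  (i : ℂ × Γ) → W.grade i.1 i.2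

/-- The projection `W → W_[n]^(β)`, where `i = (n, β)`. -/
def GenModule.proj (W : GenModule.{u} 𝒱) (i : ℂ × Γ) : W →ₗ[ℂ] W.grade i.1 i.2 :=
  W.isGrading.proj i

/-- The extension to the formal completion of an operator `T` on `W`; it is used for the operators
`v_n` and `L(j)`, for which each of the sums below is finite. -/
def GenModule.ext (W : GenModule.{u} 𝒱) (T : Module.End ℂ W) (f : W.Completion) :
    W.Completion :=
  fun i => ∑ᶠ k : ℂ × Γ, W.proj i (T (f k : W))

/-- The pairing of the graded dual with the formal completion. -/
def GenModule.pairing (W : GenModule.{u} 𝒱) (f' : W.gradedDual) (f : W.Completion) : ℂ :=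
  ∑ᶠ i : ℂ × Γ, (f' : Module.Dual ℂ W) (f i : W)

/-- The operator `τ_W (ι₊ (v ⊗ t^p (z + t)^q))`; applied to `w`, it is the coefficient of
`x₀^{-p-1} x₁^{-q-1}` in `z⁻¹δ((x₁-x₀)/z) Y(v, x₀)w`. -/
def GenModule.shiftOp (W : GenModule.{u} 𝒱) (z : ℂ) (p q : ℤ) (v : V) : Module.End ℂ W :=
  W.actSeries (fun i => binom q i * z ^ (q - i)) p v

/-- The operator `τ_W (ι₊ (v ⊗ (t - z)^p t^q))`; applied to `w`, it is the coefficient of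
`x₀^{-p-1} x₁^{-q-1}` in `x₀⁻¹δ((z-x₁)/(-x₀)) Y(v, x₁)w`. -/
def GenModule.negOp (W : GenModule.{u} 𝒱) (z : ℂ) (p q : ℤ) (v : V) : Module.End ℂ W :=
  W.actSeries (fun i => (-1 : ℂ) ^ p * (-1 : ℂ) ^ i * binom p i * z ^ (p - i)) q v

/-- The operator `∑_{i=0}^{j+1} (j+1 choose i) z^i L(j-i)`, for `j = -1, 0, 1`. -/
def GenModule.shiftL (W : GenModule.{u} 𝒱) (z : ℂ) : SignType → Module.End ℂ W
  | .neg => W.L (-1)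
  | .zero => W.L 0 + z • W.L (-1)
  | .pos => W.L 1 + (2 * z) • W.L 0 + z ^ 2 • W.L (-1)

/-- `I : W₁ ⊗ W₂ → W̄₃` is a `P(z)`-intertwining map. -/
structure IsIntertwiningMap (z : ℂ) {W₁ W₂ W₃ : GenModule.{u} 𝒱}
    (I : (W₁ ⊗[ℂ] W₂) →ₗ[ℂ] W₃.Completion) : Prop where
  grading_compat : ∀ (β γ : Γ), ∀ x ∈ W₁.gammaGrade β, ∀ y ∈ W₂.gammaGrade γ,
    ∀ i : ℂ × Γ, i.2 ≠ β + γ → I (x ⊗ₜ y) i = 0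
  lower_truncation : ∀ (x : W₁) (y : W₂) (n : ℂ), ∃ K : ℕ, ∀ k : ℕ, K ≤ k →
    ∀ β : Γ, I (x ⊗ₜ y) (n - k, β) = 0
  /-- The coefficient of `x₀^{-p-1} x₁^{-q-1}` in the Jacobi identity
  `x₀⁻¹δ((x₁-z)/x₀) Y₃(v,x₁) I(w₁ ⊗ w₂)
    = z⁻¹δ((x₁-x₀)/z) I(Y₁(v,x₀)w₁ ⊗ w₂) + x₀⁻¹δ((z-x₁)/(-x₀)) I(w₁ ⊗ Y₂(v,x₁)w₂)`,
  in each component of the completion. -/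
  jacobi : ∀ (v : V) (x : W₁) (y : W₂) (p q : ℤ) (i : ℂ × Γ),
    (∑ᶠ k : ℕ, (binom p k * (-z) ^ k) • W₃.ext (W₃.Y (p + q - k) v) (I (x ⊗ₜ y)) i)
      = I ((W₁.shiftOp z p q v x) ⊗ₜ y) i + I (x ⊗ₜ (W₂.negOp z p q v y)) i
  sl2 : ∀ (j : SignType) (x : W₁) (y : W₂),
    W₃.ext (W₃.L j) (I (x ⊗ₜ y)) = I (x ⊗ₜ (W₂.L j y)) + I ((W₁.shiftL z j x) ⊗ₜ y)

/-- The union, in `(W₁ ⊗ W₂)*`, of the images `I'(W')`, where `W` ranges over the objects of `C`,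
`I` over the `P(z)`-intertwining maps `W₁ ⊗ W₂ → W̄`, and `I'(w') = w' ∘ I` for `w' ∈ W'`. -/
def backslash (C : GenModule.{u} 𝒱 → Prop) (z : ℂ) (W₁ W₂ : GenModule.{u} 𝒱) :
    Set (Module.Dual ℂ (W₁ ⊗[ℂ] W₂)) :=
  {lam | ∃ W : GenModule.{u} 𝒱, C W ∧
    ∃ I : (W₁ ⊗[ℂ] W₂) →ₗ[ℂ] W.Completion, IsIntertwiningMap z I ∧
      ∃ w' : W.gradedDual, ∀ t : W₁ ⊗[ℂ] W₂, lam t = W.pairing w' (I t)}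

/-! ### The actions on `(W₁ ⊗ W₂)*` -/

section DualActions

variable (z : ℂ) (W₁ W₂ : GenModule.{u} 𝒱)

/-- The operator `τ_{P(z)} (ι₊ (v ⊗ (t⁻¹ - z)^p t^q))` on `(W₁ ⊗ W₂)*`: the transpose of
`τ_{W₁}((ι₊ ∘ T_z ∘ ι₋⁻¹ ∘ o)ξ) ⊗ 1 + 1 ⊗ τ_{W₂}((ι₊ ∘ ι₋⁻¹ ∘ o)ξ)`, for
`ξ = ι₊ (v ⊗ (t⁻¹ - z)^p t^q)`. Equivalently, `(tauP z W₁ W₂ p q v lam)(w₁ ⊗ w₂)` is the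
coefficient of `x₀^{-p-1} x₁^{-q-1}` in
`z⁻¹δ((x₁⁻¹-x₀)/z) lam(Y₁(e^{x₁L(1)} (-x₁⁻²)^{L(0)} v, x₀)w₁ ⊗ w₂)
  + x₀⁻¹δ((z-x₁⁻¹)/(-x₀)) lam(w₁ ⊗ Y₂°(v, x₁)w₂)`.
The elements `v ⊗ (t⁻¹ - z)^p t^q` span `V ⊗ ℂ[t, t⁻¹, (z⁻¹ - t)⁻¹]`. -/
def tauP (p q : ℤ) (v : V) : Module.End ℂ (Module.Dual ℂ (W₁ ⊗[ℂ] W₂)) :=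
  LinearMap.dualMap
    (TensorProduct.map (𝒱.opp (fun k a => W₁.shiftOp z p k a) q v) LinearMap.id
      + TensorProduct.map LinearMap.id (𝒱.opp (fun k a => W₂.negOp z p k a) q v))

/-- The component `τ_{P(z)}(v ⊗ t^n)` of `Y'_{P(z)}(v, x) = ∑ τ_{P(z)}(v ⊗ t^n) x^{-n-1}`. -/
def YP (n : ℤ) (v : V) : Module.End ℂ (Module.Dual ℂ (W₁ ⊗[ℂ] W₂)) :=
  tauP z W₁ W₂ 0 n v

/-- The operator `L'_{P(z)}(j)`, `j = -1, 0, 1`. -/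
def LP (j : SignType) : Module.End ℂ (Module.Dual ℂ (W₁ ⊗[ℂ] W₂)) :=
  LinearMap.dualMap
    (TensorProduct.map LinearMap.id (W₂.L (-j))
      + TensorProduct.map (W₁.shiftL z (-j)) LinearMap.id)

/-- The `P(z)`-compatibility condition; `COMP` is the set of all functionals satisfying it. -/
structure IsCompatible (lam : Module.Dual ℂ (W₁ ⊗[ℂ] W₂)) : Prop where
  /-- The `P(z)`-lower truncation condition. -/
  lower_truncation : ∀ v : V, ∃ N : ℤ, ∀ n : ℤ, N ≤ n → YP z W₁ W₂ n v lam = 0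
  /-- The coefficient of `x₀^{-p-1} x₁^{-q-1}` in
  `τ_{P(z)}(x₀⁻¹δ((x₁⁻¹-z)/x₀) Y_t(v,x₁)) lam = x₀⁻¹δ((x₁⁻¹-z)/x₀) Y'_{P(z)}(v,x₁) lam`. -/
  formula : ∀ (v : V) (p q : ℤ),
    tauP z W₁ W₂ p q v lam
      = ∑ᶠ i : ℕ, (binom p i * (-z) ^ i) • YP z W₁ W₂ (q - p + i) v lam

def COMP : Set (Module.Dual ℂ (W₁ ⊗[ℂ] W₂)) := {lam | IsCompatible z W₁ W₂ lam}

/-- The subspace `(W₁ ⊗ W₂)^(γ)` of the tensor product grading. -/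
def tensorGrade (γ : Γ) : Submodule ℂ (W₁ ⊗[ℂ] W₂) :=
  Submodule.span ℂ {t | ∃ β₁ β₂ : Γ, β₁ + β₂ = γ ∧
    ∃ x ∈ W₁.gammaGrade β₁, ∃ y ∈ W₂.gammaGrade β₂, t = x ⊗ₜ y}

/-- The subspace `((W₁ ⊗ W₂)*)^(β)`: the functionals that vanish on `(W₁ ⊗ W₂)^(γ)`
for all `γ ≠ -β`. -/
def dualGamma (β : Γ) : Submodule ℂ (Module.Dual ℂ (W₁ ⊗[ℂ] W₂)) :=
  ⨅ (γ : Γ) (_ : γ ≠ -β), (tensorGrade W₁ W₂ γ).dualAnnihilator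

/-- The subspace `((W₁ ⊗ W₂)*)_[n]^(β)` of generalized eigenvectors of `L'_{P(z)}(0)`. -/
def dualGen (n : ℂ) (β : Γ) : Submodule ℂ (Module.Dual ℂ (W₁ ⊗[ℂ] W₂)) :=
  (LP z W₁ W₂ 0).maxGenEigenspace n ⊓ dualGamma W₁ W₂ β

/-- The subspace `((W₁ ⊗ W₂)*)_(n)^(β)` of eigenvectors of `L'_{P(z)}(0)`. -/
def dualOrd (n : ℂ) (β : Γ) : Submodule ℂ (Module.Dual ℂ (W₁ ⊗[ℂ] W₂)) :=
  (LP z W₁ W₂ 0).eigenspace n ⊓ dualGamma W₁ W₂ β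

/-- `S` is a doubly graded subspace of `((W₁ ⊗ W₂)*)_[ℂ]^(Γ)` that contains `lam` and is stable
under the operators `τ_{P(z)}(v ⊗ t^m)` and `L'_{P(z)}(j)`. -/
structure IsStableGraded (lam : Module.Dual ℂ (W₁ ⊗[ℂ] W₂))
    (S : Submodule ℂ (Module.Dual ℂ (W₁ ⊗[ℂ] W₂))) : Prop where
  graded : S = ⨆ i : ℂ × Γ, S ⊓ dualGen z W₁ W₂ i.1 i.2
  mem : lam ∈ S
  stable_Y : ∀ (m : ℤ) (v : V), ∀ μ ∈ S, YP z W₁ W₂ m v μ ∈ S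
  stable_L : ∀ j : SignType, ∀ μ ∈ S, LP z W₁ W₂ j μ ∈ S

/-- The smallest subspace `W_lam` as in `IsStableGraded`
(used for `lam ∈ ((W₁ ⊗ W₂)*)_[ℂ]^(Γ)` only). -/
def Wgen (lam : Module.Dual ℂ (W₁ ⊗[ℂ] W₂)) : Submodule ℂ (Module.Dual ℂ (W₁ ⊗[ℂ] W₂)) :=
  sInf {S | IsStableGraded z W₁ W₂ lam S}

/-- The `P(z)`-local grading restriction condition. -/
structure IsLocallyGradingRestricted (lam : Module.Dual ℂ (W₁ ⊗[ℂ] W₂)) : Prop where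
  mem : lam ∈ ⨆ i : ℂ × Γ, dualGen z W₁ W₂ i.1 i.2
  finite_dim : ∀ (n : ℂ) (β : Γ),
    FiniteDimensional ℂ (Wgen z W₁ W₂ lam ⊓ dualGen z W₁ W₂ n β :
      Submodule ℂ (Module.Dual ℂ (W₁ ⊗[ℂ] W₂)))
  truncation : ∀ (n : ℂ) (β : Γ), ∃ K : ℤ, ∀ k : ℤ, k ≤ K →
    Wgen z W₁ W₂ lam ⊓ dualGen z W₁ W₂ (n + k) β = ⊥

/-- The `L(0)`-semisimple `P(z)`-local grading restriction condition. -/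
structure IsLocallyGradingRestrictedSS (lam : Module.Dual ℂ (W₁ ⊗[ℂ] W₂)) : Prop where
  mem : lam ∈ ⨆ i : ℂ × Γ, dualOrd z W₁ W₂ i.1 i.2
  finite_dim : ∀ (n : ℂ) (β : Γ),
    FiniteDimensional ℂ (Wgen z W₁ W₂ lam ⊓ dualOrd z W₁ W₂ n β :
      Submodule ℂ (Module.Dual ℂ (W₁ ⊗[ℂ] W₂)))
  truncation : ∀ (n : ℂ) (β : Γ), ∃ K : ℤ, ∀ k : ℤ, k ≤ K →
    Wgen z W₁ W₂ lam ⊓ dualOrd z W₁ W₂ (n + k) β = ⊥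

/-- `LGR_{[ℂ];P(z)}((W₁ ⊗ W₂)*)`. -/
def LGRgen : Set (Module.Dual ℂ (W₁ ⊗[ℂ] W₂)) :=
  {lam | IsLocallyGradingRestricted z W₁ W₂ lam}

/-- `LGR_{(ℂ);P(z)}((W₁ ⊗ W₂)*)`. -/
def LGRord : Set (Module.Dual ℂ (W₁ ⊗[ℂ] W₂)) :=
  {lam | IsLocallyGradingRestrictedSS z W₁ W₂ lam}

/-- `J` makes the generalized module `M` a generalized module included in `(W₁ ⊗ W₂)*`: it is
injective, preserves the `Γ`-grading, and intertwines the actions of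
`V ⊗ ι₊ ℂ[t, t⁻¹, (z⁻¹ - t)⁻¹]` (spanned by the `v ⊗ (t⁻¹ - z)^p t^q`, where
`ι₊ (t⁻¹ - z)^p t^q = ∑_{i ≥ 0} (p choose i) (-z)^i t^{q-p+i}`) and of `𝔰𝔩(2)`. -/
structure IsIncluded {M : GenModule.{u} 𝒱} (J : M →ₗ[ℂ] Module.Dual ℂ (W₁ ⊗[ℂ] W₂)) :
    Prop where
  injective : Function.Injective J
  grading_compat : ∀ β : Γ, ∀ x ∈ M.gammaGrade β, J x ∈ dualGamma W₁ W₂ β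
  tau : ∀ (v : V) (p q : ℤ) (x : M),
    tauP z W₁ W₂ p q v (J x)
      = J (M.actSeries (fun i => binom p i * (-z) ^ i) (q - p) v x)
  sl2 : ∀ (j : SignType) (x : M), LP z W₁ W₂ j (J x) = J (M.L j x)

/-- `W_lam` is contained in some object of `C` included in `(W₁ ⊗ W₂)*`. -/
def LiesInObject (C : GenModule.{u} 𝒱 → Prop) (lam : Module.Dual ℂ (W₁ ⊗[ℂ] W₂)) : Prop :=
  ∃ M : GenModule.{u} 𝒱, C M ∧ ∃ J : M →ₗ[ℂ] Module.Dual ℂ (W₁ ⊗[ℂ] W₂),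
    IsIncluded z W₁ W₂ J ∧ Wgen z W₁ W₂ lam ≤ LinearMap.range J

end DualActions

end Setting

end HLZ

end

/-! Transposition identifies `P(z)`-intertwining maps `I : W₁ ⊗ W₂ → W̄` with linear maps `J : W' →
(W₁ ⊗ W₂)*` that preserve the `Γ`-grading and intertwine `τ_{P(z)}` and `𝔰𝔩(2)`; the elements `w' ∘
I` are exactly the values of such `J`.

The only delicate condition is the Jacobi identity. Paired with `W'`, it says that the opposite of
`v ↦ J(v · w')` is the right-hand side of the identity as a function of `v`; the intertwining
property of `J` says the same with the opposite taken on the other side. The opposite-operator map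
is an involution (`VertexAlgebra.opp_opp`), so the two are equivalent (`IsDuality.jacobi_iff`).

For `⊆`, an element `w' ∘ I` is a value `J y`. Compatibility is the image under `J` of a finite sum
in the module. The range of `J` is stable and graded, hence contains `W_{J y}`, and its weight
spaces are images of those of the module, because generalized eigenspaces and `Γ`-degrees are
independent. The local grading restriction is thus inherited (`IsDualMap.mem_COMP`,
`IsDualMap.mem_LGRgen`, `IsDualMap.mem_LGRord`).

For `⊇`, the hypothesis puts `lam ∈ W_lam` in the range of some `J : M → (W₁ ⊗ W₂)*` with `M` in
`C`. Reading `J` componentwise gives an intertwining map into the completion of the contragredient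
of `M`, again in `C`, whose transpose is `J` (`IsContragredient.exists_transpose_eq`,
`IsDuality.isIntertwiningMap`). -/

namespace HLZ

/-! ### Projections of a graded space. -/

section Gradings

variable {ι : Type*} {M : Type*} [AddCommGroup M] [Module ℂ M] {G : ι → Submodule ℂ M}

open scoped Classical in
theorem IsGrading.proj_of_mem (h : IsGrading G) {i : ι} {x : M} (hx : x ∈ G i) :
    (h.proj i x : M) = x := by
  have e : (LinearEquiv.ofBijective (DirectSum.coeLinearMap G) h).symm x
      = DirectSum.lof ℂ ι (fun i => G i) i ⟨x, hx⟩ := by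
    exact (LinearEquiv.symm_apply_eq _).2 (DirectSum.coeLinearMap_lof G i ⟨x, hx⟩).symm
  simp only [IsGrading.proj, LinearMap.comp_apply, LinearEquiv.coe_coe]
  erw [e, DirectSum.component.lof_self]

open scoped Classical in
theorem IsGrading.proj_of_ne (h : IsGrading G) {i j : ι} {x : M} (hx : x ∈ G i) (hij : i ≠ j) :
    h.proj j x = 0 := by
  have e : (LinearEquiv.ofBijective (DirectSum.coeLinearMap G) h).symm x
      = DirectSum.lof ℂ ι (fun i => G i) i ⟨x, hx⟩ := by
    exact (LinearEquiv.symm_apply_eq _).2 (DirectSum.coeLinearMap_lof G i ⟨x, hx⟩).symm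
  simp only [IsGrading.proj, LinearMap.comp_apply, LinearEquiv.coe_coe]
  erw [e, DirectSum.component.of]
  simp [hij]

open scoped Classical in
theorem IsGrading.induction_on (h : IsGrading G) {p : M → Prop} (x : M)
    (mem : ∀ i, ∀ x ∈ G i, p x) (add : ∀ x y, p x → p y → p (x + y)) (zero : p 0) : p x := by
  have hx : x ∈ ⨆ i, G i := by
    rw [DirectSum.IsInternal.submodule_iSup_eq_top h]; trivial
  exact Submodule.iSup_induction G (motive := p) hx mem zero add

theorem IsGrading.finite_support (h : IsGrading G) (x : M) :
    (Function.support fun i => (h.proj i x : M)).Finite := by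
  refine h.induction_on (p := fun x => (Function.support fun i => (h.proj i x : M)).Finite) x ?_ ?_ ?_
  · intro i x hx
    refine (Set.finite_singleton i).subset fun j hj => ?_
    by_contra hne
    exact hj (by simp [h.proj_of_ne hx (Ne.symm hne)])
  · intro x y hx hy
    refine (hx.union hy).subset ?_
    simp only [map_add, Submodule.coe_add]
    exact Function.support_add _ _
  · simp

theorem IsGrading.finsum_proj (h : IsGrading G) (x : M) : ∑ᶠ i, (h.proj i x : M) = x := by
  refine h.induction_on (p := fun x => ∑ᶠ i, (h.proj i x : M) = x) x ?_ ?_ ?_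
  · intro i x hx
    rw [finsum_eq_single _ i fun j hj => by rw [h.proj_of_ne hx hj.symm]; rfl]
    exact h.proj_of_mem hx
  · intro x y hx hy
    simp only [map_add, Submodule.coe_add]
    rw [finsum_add_distrib (h.finite_support x) (h.finite_support y), hx, hy]
  · simp

/-- A homogeneity criterion: all other components vanish. -/
theorem IsGrading.mem_of_proj (h : IsGrading G) {i : ι} {x : M}
    (hx : ∀ j, j ≠ i → h.proj j x = 0) : x ∈ G i := by
  have := h.finsum_proj x
  rw [finsum_eq_single _ i fun j hj => by rw [hx j hj]; rfl] at this
  rw [← this]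
  exact (h.proj i x).2

theorem IsGrading.proj_iSup_of_ne (h : IsGrading G) {κ : Type*} {f : κ → ι} {j : ι} {x : M}
    (hx : x ∈ ⨆ k, G (f k)) (hj : ∀ k, f k ≠ j) : h.proj j x = 0 := by
  refine Submodule.iSup_induction (fun k => G (f k)) (motive := fun x => h.proj j x = 0) hx ?_ ?_ ?_
  · intro k x hx
    exact h.proj_of_ne hx (hj k)
  · simp
  · intro x y hx hy
    simp [hx, hy]

end Gradings

section Setting

variable {Γ : Type w} [AddCommGroup Γ] {A : AddSubgroup Γ}
  {V : Type v} [AddCommGroup V] [Module ℂ V]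

/-! ### The opposite-operator map is an involution -/

namespace VertexAlgebra

variable (𝒱 : VertexAlgebra A V)

theorem proj_L_zero (i : ℤ × A) (x : V) :
    (𝒱.isGrading.proj i (𝒱.L 0 x) : V) = (i.1 : ℂ) • (𝒱.isGrading.proj i x : V) := by
  refine 𝒱.isGrading.induction_on
    (p := fun x => (𝒱.isGrading.proj i (𝒱.L 0 x) : V) = (i.1 : ℂ) • (𝒱.isGrading.proj i x : V))
    x ?_ ?_ ?_
  · intro j x hx
    rw [𝒱.L_zero _ _ x hx]
    by_cases hj : j = i
    · subst hj
      simp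
    · rw [map_smul, 𝒱.isGrading.proj_of_ne hx hj]
      simp
  · intro x y hx hy
    simp only [map_add, Submodule.coe_add, hx, hy, smul_add]
  · simp

/-- The bracket `[L(0), L(1)] = -L(1)` makes `L(1)x` an eigenvector of eigenvalue `h - 1`, and
`L(1)` preserves the `A`-degree; together these kill every other component. -/
theorem L_one_mem {h : ℤ} {α : A} {x : V} (hx : x ∈ 𝒱.grade h α) :
    𝒱.L 1 x ∈ 𝒱.grade (h - 1) α := by
  have hw : 𝒱.L 0 (𝒱.L 1 x) = ((h - 1 : ℤ) : ℂ) • 𝒱.L 1 x := by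
    have := congrArg (fun T : Module.End ℂ V => T x) 𝒱.action.bracket_zero_pos
    simp only [LinearMap.sub_apply, Module.End.mul_apply, LinearMap.neg_apply,
      𝒱.L_zero _ _ x hx, map_smul] at this
    rw [sub_eq_iff_eq_add] at this
    rw [this]
    push_cast
    module
  refine 𝒱.isGrading.mem_of_proj (i := (h - 1, α)) fun j hj => ?_
  by_cases hα : j.2 = α
  · have h1 : j.1 ≠ h - 1 := fun e => hj (Prod.ext e hα)
    have := 𝒱.proj_L_zero j (𝒱.L 1 x)
    rw [hw, map_smul, Submodule.coe_smul, ← sub_eq_zero, ← sub_smul, smul_eq_zero] at this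
    rcases this with this | this
    · exact absurd (by exact_mod_cast (sub_eq_zero.1 this).symm) h1
    · exact Subtype.ext this
  · have h2 := 𝒱.L_mem 1 α x (Submodule.mem_iSup_of_mem h hx)
    exact 𝒱.isGrading.proj_iSup_of_ne (f := fun k => (k, α)) h2
      fun k e => hα (by rw [← e])

theorem L_one_pow_mem {h : ℤ} {α : A} {x : V} (hx : x ∈ 𝒱.grade h α) (m : ℕ) :
    (𝒱.L 1 ^ m) x ∈ 𝒱.grade (h - m) α := by
  induction m with
  | zero => simpa using hx
  | succ m ih =>
    rw [pow_succ', Module.End.mul_apply]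
    convert 𝒱.L_one_mem ih using 2
    push_cast
    ring

/-- `L(1)` lowers weights within one `A`-degree, where weights are bounded below. This is what makes
the exponential `e^{xL(1)}` in `opp` a finite sum. -/
theorem exists_L_one_pow_eq_zero {h : ℤ} {α : A} {x : V} (hx : x ∈ 𝒱.grade h α) :
    ∃ K : ℕ, ∀ m, K ≤ m → (𝒱.L 1 ^ m) x = 0 := by
  obtain ⟨N, hN⟩ := 𝒱.grading_restriction α
  refine ⟨(h - N).toNat, fun m hm => ?_⟩
  have := 𝒱.L_one_pow_mem hx m
  rw [hN _ (by omega)] at this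
  simpa using this

theorem finite_opp_support (v : V) :
    {s : (ℤ × A) × ℕ | (𝒱.L 1 ^ s.2) (𝒱.isGrading.proj s.1 v : V) ≠ 0}.Finite := by
  choose K hK using fun i : ℤ × A => 𝒱.exists_L_one_pow_eq_zero (𝒱.isGrading.proj i v).2
  refine ((𝒱.isGrading.finite_support v).biUnion
    fun i _ => ((Set.finite_lt_nat (K i)).image (Prod.mk i))).subset ?_
  rintro ⟨i, m⟩ hs
  simp only [Set.mem_iUnion]
  refine ⟨i, fun h0 => hs ?_, m, ?_, rfl⟩
  · simp [h0]
  · by_contra hm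
    exact hs (hK i m (not_lt.1 hm))

variable {U : Type*} [AddCommGroup U] [Module ℂ U]

theorem finite_opp (Φ : ℤ → V →ₗ[ℂ] U) (n : ℤ) (v : V) :
    (Function.support fun s : (ℤ × A) × ℕ => ((-1 : ℂ) ^ s.1.1 / (s.2.factorial : ℂ)) •
      Φ (2 * s.1.1 - s.2 - 2 - n) ((𝒱.L 1 ^ s.2) (𝒱.isGrading.proj s.1 v : V))).Finite :=
  (𝒱.finite_opp_support v).subset fun s hs h0 => hs (by simp [h0])

/-- `𝒱.opp` applied to a family of linear maps, as a linear map. -/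
noncomputable def oppLin (Φ : ℤ → V →ₗ[ℂ] U) (n : ℤ) : V →ₗ[ℂ] U where
  toFun := 𝒱.opp (fun k a => Φ k a) n
  map_add' x y := by
    unfold opp
    rw [← finsum_add_distrib (𝒱.finite_opp Φ n x) (𝒱.finite_opp Φ n y)]
    simp
  map_smul' c x := by
    unfold opp
    rw [RingHom.id_apply, smul_finsum' c (𝒱.finite_opp Φ n x)]
    refine finsum_congr fun s => ?_
    simp only [map_smul, Submodule.coe_smul]
    rw [smul_comm]

theorem oppLin_apply (Φ : ℤ → V →ₗ[ℂ] U) (n : ℤ) (v : V) :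
    𝒱.oppLin Φ n v = 𝒱.opp (fun k a => Φ k a) n v := rfl

theorem map_opp {U' : Type*} [AddCommGroup U'] [Module ℂ U'] (g : U →ₗ[ℂ] U')
    (Φ : ℤ → V →ₗ[ℂ] U) (n : ℤ) (v : V) :
    g (𝒱.opp (fun k a => Φ k a) n v) = 𝒱.opp (fun k a => g (Φ k a)) n v := by
  unfold opp
  rw [map_finsum g (𝒱.finite_opp Φ n v)]
  simp

theorem opp_of_mem (Φ : ℤ → V →ₗ[ℂ] U) (n : ℤ) {h : ℤ} {α : A} {x : V}
    (hx : x ∈ 𝒱.grade h α) :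
    𝒱.opp (fun k a => Φ k a) n x = ∑ᶠ m : ℕ, ((-1 : ℂ) ^ h / (m.factorial : ℂ)) •
      Φ (2 * h - m - 2 - n) ((𝒱.L 1 ^ m) x) := by
  unfold opp
  rw [finsum_curry _ (𝒱.finite_opp Φ n x), finsum_eq_single _ (h, α)]
  · refine finsum_congr fun m => ?_
    rw [𝒱.isGrading.proj_of_mem (i := (h, α)) hx]
  · intro j hj
    simp [𝒱.isGrading.proj_of_ne (i := (h, α)) hx hj.symm]

/-- The coefficient of degree `k` in `e^{-x} e^x = 1`, obtained by expanding `(-1 + 1)^k / k!`. -/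
theorem sum_antidiagonal_factorial (k : ℕ) :
    ∑ p ∈ Finset.HasAntidiagonal.antidiagonal k, (-1 : ℂ) ^ p.1 / (p.1.factorial * p.2.factorial : ℂ)
      = if k = 0 then 1 else 0 := by
  have h := Commute.add_pow' (Commute.all (-1 : ℂ) 1) k
  have h2 : (k.factorial : ℂ) ≠ 0 := by exact_mod_cast k.factorial_ne_zero
  have h3 : ∑ p ∈ Finset.HasAntidiagonal.antidiagonal k, (-1 : ℂ) ^ p.1 / (p.1.factorial * p.2.factorial : ℂ)
      = (∑ p ∈ Finset.HasAntidiagonal.antidiagonal k, k.choose p.1 • ((-1 : ℂ) ^ p.1 * 1 ^ p.2))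
        / k.factorial := by
    rw [Finset.sum_div]
    refine Finset.sum_congr rfl fun p hp => ?_
    rw [Finset.HasAntidiagonal.mem_antidiagonal] at hp
    have e : (k.choose p.1 : ℂ) * p.1.factorial * p.2.factorial = k.factorial := by
      subst hp
      rw [Nat.choose_symm_add]
      exact_mod_cast Nat.add_choose_mul_factorial_mul_factorial p.1 p.2
    have h4 : (p.1.factorial : ℂ) ≠ 0 := by exact_mod_cast p.1.factorial_ne_zero
    have h5 : (p.2.factorial : ℂ) ≠ 0 := by exact_mod_cast p.2.factorial_ne_zero
    rw [nsmul_eq_mul, one_pow, mul_one, div_eq_div_iff (mul_ne_zero h4 h5) h2, ← e]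
    ring
  rw [h3, ← h]
  split_ifs with hk
  · subst hk; simp
  · simp [hk]

/-- For homogeneous `v` the double opposite is a sum over pairs `(m, l)` whose term depends on `m +
l`, up to the coefficient `(-1)^m / (m! l!)`. Grouping by `k = m + l` leaves only `k = 0`. -/
theorem opp_opp (Φ : ℤ → V →ₗ[ℂ] U) (n : ℤ) (v : V) :
    𝒱.opp (fun k a => 𝒱.opp (fun k a => Φ k a) k a) n v = Φ n v := by
  refine 𝒱.isGrading.induction_on
    (p := fun v => 𝒱.opp (fun k a => 𝒱.oppLin Φ k a) n v = Φ n v) v ?_ ?_ ?_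
  · rintro ⟨h, α⟩ x hx
    rw [𝒱.opp_of_mem _ _ hx]
    obtain ⟨K, hK⟩ := 𝒱.exists_L_one_pow_eq_zero hx
    have e : ∀ m : ℕ, 𝒱.oppLin Φ (2 * h - m - 2 - n) ((𝒱.L 1 ^ m) x)
        = ∑ l ∈ Finset.range K, ((-1 : ℂ) ^ (h - m) / (l.factorial : ℂ)) •
          Φ (n - m - l) ((𝒱.L 1 ^ (m + l)) x) := by
      intro m
      rw [oppLin_apply, 𝒱.opp_of_mem _ _ (𝒱.L_one_pow_mem hx m),
        finsum_eq_sum_of_support_subset (s := Finset.range K)]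
      · refine Finset.sum_congr rfl fun l _ => ?_
        rw [← Module.End.mul_apply, ← pow_add, add_comm l m]
        congr 3
        ring
      · intro l hl
        rw [Finset.coe_range, Set.mem_Iio]
        by_contra hlt
        refine hl ?_
        simp only []
        rw [← Module.End.mul_apply, ← pow_add, hK _ (by omega)]
        simp
    simp only [e]
    rw [finsum_eq_sum_of_support_subset (s := Finset.range K)]
    · have key : ∑ m ∈ Finset.range K, ∑ l ∈ Finset.range K,
          ((-1 : ℂ) ^ m / (m.factorial * l.factorial : ℂ)) •
            Φ (n - (m + l : ℕ)) ((𝒱.L 1 ^ (m + l)) x) = Φ n x := by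
        rw [← Finset.sum_product',
          ← Finset.sum_fiberwise_of_maps_to (t := Finset.range (2 * K)) (g := fun p => p.1 + p.2)]
        · have : ∀ k ∈ Finset.range (2 * K), ∑ p ∈ Finset.range K ×ˢ Finset.range K with p.1 + p.2 = k,
              ((-1 : ℂ) ^ p.1 / (p.1.factorial * p.2.factorial : ℂ)) •
                Φ (n - (p.1 + p.2 : ℕ)) ((𝒱.L 1 ^ (p.1 + p.2)) x)
              = (if k = 0 then (1 : ℂ) else 0) • Φ (n - k) ((𝒱.L 1 ^ k) x) := by
            intro k _
            -- The fibre over `k` inside the box is the whole antidiagonal only when `k < K`; for `k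
            -- ≥ K` the power `L(1)^k` already vanishes.
            by_cases hk : K ≤ k
            · rw [hK k hk]
              refine (Finset.sum_eq_zero fun p hp => ?_).trans (by simp)
              rw [(Finset.mem_filter.1 hp).2, hK k hk]
              simp
            · rw [← sum_antidiagonal_factorial, Finset.sum_smul]
              refine Finset.sum_congr ?_ fun p hp => ?_
              · ext p
                simp only [Finset.mem_filter, Finset.mem_product, Finset.mem_range,
                  Finset.HasAntidiagonal.mem_antidiagonal]
                omega
              · rw [Finset.HasAntidiagonal.mem_antidiagonal.1 hp]
          rw [Finset.sum_congr rfl this]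
          by_cases hK0 : K = 0
          · subst hK0
            have : x = 0 := by simpa using hK 0 le_rfl
            simp [this]
          · rw [Finset.sum_eq_single 0]
            · simp
            · intro k _ hk
              simp [hk]
            · intro h0
              simp at h0
              omega
        · intro p hp
          simp only [Finset.mem_product, Finset.mem_range] at hp ⊢
          omega
      rw [← key]
      refine Finset.sum_congr rfl fun m _ => ?_
      rw [Finset.smul_sum]
      refine Finset.sum_congr rfl fun l _ => ?_
      rw [smul_smul]
      -- The inner sign has exponent `h - m` because `L(1)^m x` has that weight.
      have h1 : (-1 : ℂ) ^ h * (-1 : ℂ) ^ (h - m) = (-1 : ℂ) ^ m := by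
        rw [← zpow_add₀ (by norm_num), show h + (h - m) = 2 * (h - m) + m by ring,
          zpow_add₀ (by norm_num), zpow_mul]
        norm_num
      congr 1
      · rw [← h1]
        field_simp
      · congr 2
        push_cast
        ring
    · intro m hm
      rw [Finset.coe_range, Set.mem_Iio]
      by_contra hlt
      refine hm ?_
      simp only []
      rw [Finset.sum_eq_zero, smul_zero]
      intro l _
      rw [hK _ (by omega)]
      simp
  · intro x y hx hy
    simp only [← oppLin_apply, map_add] at hx hy ⊢
    rw [hx, hy]
  · simp [← oppLin_apply]

theorem oppLin_oppLin (Φ : ℤ → V →ₗ[ℂ] U) : 𝒱.oppLin (𝒱.oppLin Φ) = Φ := by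
  ext n v
  exact 𝒱.opp_opp Φ n v

theorem map_oppLin {U' : Type*} [AddCommGroup U'] [Module ℂ U'] (g : U →ₗ[ℂ] U')
    (Φ : ℤ → V →ₗ[ℂ] U) (n : ℤ) (v : V) :
    g (𝒱.oppLin Φ n v) = 𝒱.oppLin (fun k => g ∘ₗ Φ k) n v :=
  𝒱.map_opp g Φ n v

theorem oppLin_add (Φ Ψ : ℤ → V →ₗ[ℂ] U) (n : ℤ) (v : V) :
    𝒱.oppLin (fun k => Φ k + Ψ k) n v = 𝒱.oppLin Φ n v + 𝒱.oppLin Ψ n v := by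
  simp only [oppLin_apply, opp]
  rw [← finsum_add_distrib (𝒱.finite_opp Φ n v) (𝒱.finite_opp Ψ n v)]
  simp

end VertexAlgebra

end Setting

/-! ### Finiteness tested by functionals. -/

section FiniteDimensional

/-- A family in a finite-dimensional space has finite support if its images under the functionals
of a separating family have. -/
theorem finite_support_of_separating {E K P : Type*} [AddCommGroup E] [Module ℂ E]
    [FiniteDimensional ℂ E] [AddCommGroup P] [Module ℂ P] (B : P →ₗ[ℂ] E →ₗ[ℂ] ℂ)
    (sep : ∀ x, (∀ y, B y x = 0) → x = 0) (f : K → E)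
    (hf : ∀ y, (Function.support fun k => B y (f k)).Finite) :
    (Function.support f).Finite := by
  -- In finite dimension a subspace of the dual with zero common kernel is the whole dual, so the
  -- coordinate functionals are among the `B y`.
  have htop : LinearMap.range B = ⊤ := by
    have h0 : (LinearMap.range B : Submodule ℂ (Module.Dual ℂ E)).dualCoannihilator = ⊥ := by
      rw [eq_bot_iff]
      intro x hx
      rw [Submodule.mem_dualCoannihilator] at hx
      exact (Submodule.mem_bot ℂ).2 (sep x fun y => hx _ ⟨y, rfl⟩)
    have := Subspace.dualCoannihilator_dualAnnihilator_eq
      (W := (LinearMap.range B : Submodule ℂ (Module.Dual ℂ E)))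
    rw [← this, h0, Submodule.dualAnnihilator_bot]
  let b := Module.finBasis ℂ E
  have hc : ∀ j, ∃ y, B y = b.coord j := fun j => by
    have : b.coord j ∈ LinearMap.range B := by rw [htop]; trivial
    exact this
  choose y hy using hc
  refine (Set.finite_iUnion fun j => hf (y j)).subset fun k hk => ?_
  by_contra hne
  refine hk (b.ext_elem fun j => ?_)
  rw [Set.mem_iUnion, not_exists] at hne
  have := hne j
  rw [Function.mem_support, not_not, hy] at this
  simpa using this

end FiniteDimensional

section Setting

variable {Γ : Type w} [AddCommGroup Γ] {A : AddSubgroup Γ}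
  {V : Type v} [AddCommGroup V] [Module ℂ V] {𝒱 : VertexAlgebra A V}

/-! ### Linearity in the algebra element -/

namespace GenModule

variable (W : GenModule.{u} 𝒱)

theorem finite_actSeries (a : ℕ → ℂ) (N : ℤ) (v : V) (x : W) :
    (Function.support fun i : ℕ => a i • W.Y (N + i) v x).Finite := by
  obtain ⟨K, hK⟩ := W.action.truncation v x
  refine (Set.finite_lt_nat (K - N).toNat).subset fun i hi => ?_
  by_contra hlt
  have h : K ≤ N + i := by
    have : ¬ i < (K - N).toNat := hlt
    omega
  exact hi (by simp [hK _ h])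

theorem actSeries_apply (a : ℕ → ℂ) (N : ℤ) (v : V) (x : W) :
    W.actSeries a N v x = ∑ᶠ i : ℕ, a i • W.Y (N + i) v x := rfl

/-- `GenModule.actSeries` as a linear map in the algebra element. -/
noncomputable def actSeriesLin (a : ℕ → ℂ) (N : ℤ) : V →ₗ[ℂ] Module.End ℂ W where
  toFun := W.actSeries a N
  map_add' u v := by
    ext x
    rw [LinearMap.add_apply, actSeries_apply, actSeries_apply, actSeries_apply,
      ← finsum_add_distrib (W.finite_actSeries a N u x) (W.finite_actSeries a N v x)]
    simp
  map_smul' c v := by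
    ext x
    rw [RingHom.id_apply, LinearMap.smul_apply, actSeries_apply, actSeries_apply,
      smul_finsum' c (W.finite_actSeries a N v x)]
    refine finsum_congr fun i => ?_
    rw [map_smul, LinearMap.smul_apply, smul_comm]

/-- The action `τ_W (v ⊗ ι₊ (t⁻¹ - z)^p t^q)`. -/
noncomputable def powOp (z : ℂ) (p q : ℤ) : V →ₗ[ℂ] Module.End ℂ W :=
  W.actSeriesLin (fun i => binom p i * (-z) ^ i) (q - p)

noncomputable def shiftOpLin (z : ℂ) (p q : ℤ) : V →ₗ[ℂ] Module.End ℂ W :=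
  W.actSeriesLin (fun i => binom q i * z ^ (q - i)) p

noncomputable def negOpLin (z : ℂ) (p q : ℤ) : V →ₗ[ℂ] Module.End ℂ W :=
  W.actSeriesLin (fun i => (-1 : ℂ) ^ p * (-1 : ℂ) ^ i * binom p i * z ^ (p - i)) q

/-- The opposite vertex operator `Y°(v, x)`. -/
noncomputable def oppY (n : ℤ) : V →ₗ[ℂ] Module.End ℂ W := 𝒱.oppLin W.Y n

theorem powOp_apply (z : ℂ) (p q : ℤ) (v : V) (x : W) :
    W.powOp z p q v x = ∑ᶠ i : ℕ, (binom p i * (-z) ^ i) • W.Y (q - p + i) v x := rfl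

theorem finite_powOp (z : ℂ) (p q : ℤ) (v : V) (x : W) :
    (Function.support fun i : ℕ => (binom p i * (-z) ^ i) • W.Y (q - p + i) v x).Finite :=
  W.finite_actSeries _ _ v x

theorem oppY_eq_sum (n : ℤ) (v : V) (x : W) :
    W.oppY n v x = ∑ s ∈ (𝒱.finite_opp_support v).toFinset,
      ((-1 : ℂ) ^ s.1.1 / (s.2.factorial : ℂ)) •
      W.Y (2 * s.1.1 - s.2 - 2 - n) ((𝒱.L 1 ^ s.2) (𝒱.isGrading.proj s.1 v : V)) x := by
  change LinearMap.applyₗ x (𝒱.opp (fun k a => W.Y k a) n v) = _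
  rw [𝒱.map_opp]
  unfold VertexAlgebra.opp
  rw [finsum_eq_sum_of_support_subset]
  · rfl
  · intro s hs
    rw [Set.Finite.coe_toFinset]
    intro h0
    exact hs (by simp [h0])

/-- Passing to the opposite reverses the index: decreasing `N - k` means increasing indices in `Y`,
so ordinary lower truncation applies to each of the finitely many terms. -/
theorem finite_oppY (c : ℕ → ℂ) (N : ℤ) (v : V) (x : W) :
    (Function.support fun k : ℕ => c k • W.oppY (N - k) v x).Finite := by
  have : ∀ k : ℕ, c k • W.oppY (N - k) v x = ∑ s ∈ (𝒱.finite_opp_support v).toFinset,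
      ((-1 : ℂ) ^ s.1.1 / (s.2.factorial : ℂ)) • c k •
      W.Y (2 * s.1.1 - s.2 - 2 - N + k) ((𝒱.L 1 ^ s.2) (𝒱.isGrading.proj s.1 v : V)) x := by
    intro k
    rw [oppY_eq_sum, Finset.smul_sum]
    refine Finset.sum_congr rfl fun s _ => ?_
    rw [smul_comm]
    congr 4
    ring_nf
  simp only [this]
  refine (Set.Finite.biUnion (𝒱.finite_opp_support v) fun s _ =>
    W.finite_actSeries c (2 * s.1.1 - s.2 - 2 - N)
      ((𝒱.L 1 ^ s.2) (𝒱.isGrading.proj s.1 v : V)) x).subset ?_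
  intro k hk
  by_contra hne
  refine hk (Finset.sum_eq_zero fun s hs => ?_)
  simp only [Set.mem_iUnion, not_exists, Function.mem_support, not_not] at hne
  rw [hne s (by simpa using hs), smul_zero]

/-- Under the opposite map `t` becomes `t⁻¹`, so the expansion of `(t⁻¹ - z)^p t^q` turns into the
coefficients on the left of the Jacobi identity. Both sides are one double sum in two orders. -/
theorem opp_powOp (z : ℂ) (p q : ℤ) (v : V) (x : W) :
    𝒱.oppLin (W.powOp z p) q v x
      = ∑ᶠ k : ℕ, (binom p k * (-z) ^ k) • W.oppY (p + q - k) v x := by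
  have h : ∀ k : ℕ, (binom p k * (-z) ^ k) • W.oppY (p + q - k) v x
      = ∑ s ∈ (𝒱.finite_opp_support v).toFinset,
      ((-1 : ℂ) ^ s.1.1 / (s.2.factorial : ℂ)) • (binom p k * (-z) ^ k) •
      W.Y (2 * s.1.1 - s.2 - 2 - q - p + k)
        ((𝒱.L 1 ^ s.2) (𝒱.isGrading.proj s.1 v : V)) x := by
    intro k
    rw [oppY_eq_sum, Finset.smul_sum]
    refine Finset.sum_congr rfl fun s _ => ?_
    rw [smul_comm]
    congr 4
    ring_nf
  simp only [h]
  rw [finsum_sum_comm]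
  · change LinearMap.applyₗ x (𝒱.opp (fun k a => W.powOp z p k a) q v) = _
    rw [𝒱.map_opp]
    unfold VertexAlgebra.opp
    rw [finsum_eq_sum_of_support_subset (s := (𝒱.finite_opp_support v).toFinset)]
    · refine Finset.sum_congr rfl fun s _ => ?_
      rw [← smul_finsum' _ (W.finite_powOp z p _ _ x)]
      rfl
    · intro s hs
      rw [Set.Finite.coe_toFinset]
      intro h0
      exact hs (by simp [h0])
  · intro s _
    exact (W.finite_powOp z p _ _ x).subset fun k hk h0 => hk (by
      simp only [] at h0 ⊢
      rw [h0, smul_zero])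

end GenModule

/-! ### Duality between generalized modules -/

/-- `B` is a homogeneous pairing of `N` and `W`, separating points of `W`, for which the
action on `N` is adjoint to the opposite of the action on `W`. -/
structure IsDuality (W N : GenModule.{u} 𝒱) (B : N →ₗ[ℂ] W →ₗ[ℂ] ℂ) : Prop where
  graded : ∀ (i j : ℂ × Γ), i.1 ≠ j.1 ∨ i.2 ≠ -j.2 → ∀ y ∈ N.grade i.1 i.2,
    ∀ x ∈ W.grade j.1 j.2, B y x = 0
  sep : ∀ x, (∀ y, B y x = 0) → x = 0
  adj_Y : ∀ (n : ℤ) (v : V) (y : N) (x : W), B y (W.Y n v x) = B (N.oppY n v y) x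
  adj_L : ∀ (j : SignType) (y : N) (x : W), B y (W.L j x) = B (N.L (-j) y) x

/-- The contragredient expresses the action on `N` as the opposite of that on `W`; the adjunction
needed here goes the other way and follows from the involution. -/
theorem IsContragredient.exists_isDuality {W N : GenModule.{u} 𝒱} (h : IsContragredient W N) :
    ∃ φ : N ≃ₗ[ℂ] W.gradedDual, IsDuality W N (W.gradedDual.subtype ∘ₗ φ.toLinearMap) := by
  obtain ⟨φ, hY, hL, hg⟩ := h
  refine ⟨φ, ?_, ?_, ?_, ?_⟩
  · intro i j hij y hy x hx
    refine (hg _ _ y).1 hy j.1 j.2 (fun e => ?_) x hx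
    simp only [Prod.mk.injEq] at e
    rcases hij with h | h
    · exact h e.1.symm
    · exact h (by rw [e.2, neg_neg])
  · intro x hx
    have hp : ∀ i : ℂ × Γ, (W.proj i x : W) = 0 := by
      intro i
      have := W.finite_dim i.1 i.2
      rw [ZeroMemClass.coe_eq_zero, ← Module.forall_dual_apply_eq_zero_iff ℂ]
      intro l
      -- A functional on one component, extended by zero, is homogeneous in the graded dual; this is
      -- why the graded dual separates points.
      have hl : l ∘ₗ W.proj i ∈ W.gradedDual := by
        refine Submodule.mem_iSup_of_mem (i.1, -i.2) fun m γ hne x hx => ?_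
        have : W.proj i x = 0 := W.isGrading.proj_of_ne (i := (m, γ)) hx (by simpa using hne)
        simp [this]
      simpa using hx (φ.symm ⟨_, hl⟩)
    rw [← W.isGrading.finsum_proj x]
    exact finsum_eq_zero_of_forall_eq_zero hp
  · intro n v y x
    let g : Module.End ℂ N →ₗ[ℂ] ℂ :=
      LinearMap.applyₗ x ∘ₗ W.gradedDual.subtype ∘ₗ φ.toLinearMap ∘ₗ LinearMap.applyₗ y
    let g' : Module.End ℂ W →ₗ[ℂ] ℂ := (φ y : Module.Dual ℂ W) ∘ₗ LinearMap.applyₗ x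
    have e : (fun k => g ∘ₗ N.Y k) = fun k => g' ∘ₗ W.oppY k := by
      ext k a
      exact hY k a y x
    change g' (W.Y n v) = g (𝒱.oppLin N.Y n v)
    rw [𝒱.map_oppLin, e, ← 𝒱.map_oppLin]
    change _ = g' (𝒱.oppLin (𝒱.oppLin W.Y) n v)
    rw [𝒱.oppLin_oppLin]
  · intro j y x
    simp [hL]

end Setting

section Setting

variable {Γ : Type w} [AddCommGroup Γ] {A : AddSubgroup Γ}
  {V : Type v} [AddCommGroup V] [Module ℂ V] {𝒱 : VertexAlgebra A V}

namespace IsDuality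

variable {W N : GenModule.{u} 𝒱} {B : N →ₗ[ℂ] W →ₗ[ℂ] ℂ} (D : IsDuality W N B)

include D in
theorem finite_grades (y : N) :
    {i : ℂ × Γ | ∃ x ∈ W.grade i.1 i.2, B y x ≠ 0}.Finite := by
  refine N.isGrading.induction_on
    (p := fun y => {i : ℂ × Γ | ∃ x ∈ W.grade i.1 i.2, B y x ≠ 0}.Finite) y ?_ ?_ ?_
  · intro i y hy
    refine (Set.finite_singleton (i.1, -i.2)).subset ?_
    rintro j ⟨x, hx, hB⟩
    by_contra hne
    refine hB (D.graded i j ?_ y hy x hx)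
    by_contra h
    push Not at h
    exact hne (Prod.ext h.1.symm (by rw [h.2, neg_neg]))
  · intro y y' hy hy'
    refine (hy.union hy').subset ?_
    rintro j ⟨x, hx, hB⟩
    by_contra hne
    simp only [Set.mem_union, Set.mem_ofPred_eq, not_or, not_exists, not_and, not_not] at hne
    exact hB (by rw [map_add, LinearMap.add_apply, hne.1 x hx, hne.2 x hx, add_zero])
  · simp

include D in
theorem finite_support (y : N) (f : W.Completion) :
    (Function.support fun i => B y (f i : W)).Finite :=
  (D.finite_grades y).subset fun i hi => ⟨f i, (f i).2, hi⟩

/-- The pairing of `N` with the formal completion of `W`. -/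
noncomputable def pair : N →ₗ[ℂ] W.Completion →ₗ[ℂ] ℂ :=
  LinearMap.mk₂ ℂ (fun y f => ∑ᶠ i : ℂ × Γ, B y (f i : W))
    (fun y y' f => by
      rw [← finsum_add_distrib (D.finite_support y f) (D.finite_support y' f)]
      simp)
    (fun c y f => by
      rw [smul_finsum' c (D.finite_support y f)]
      simp)
    (fun y f f' => by
      rw [← finsum_add_distrib (D.finite_support y f) (D.finite_support y f')]
      simp)
    (fun c y f => by
      rw [smul_finsum' c (D.finite_support y f)]
      simp)

theorem pair_apply (y : N) (f : W.Completion) :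
    D.pair y f = ∑ᶠ i : ℂ × Γ, B y (f i : W) := rfl

theorem pair_of_mem {n : ℂ} {β : Γ} {y : N} (hy : y ∈ N.grade n (-β)) (f : W.Completion) :
    D.pair y f = B y (f (n, β) : W) := by
  rw [pair_apply]
  refine finsum_eq_single _ _ fun j hj => D.graded (n, -β) j ?_ y hy _ (f j).2
  by_contra h
  push Not at h
  exact hj (Prod.ext h.1.symm (neg_injective h.2).symm)

include D in
theorem apply_proj {n : ℂ} {β : Γ} {y : N} (hy : y ∈ N.grade n (-β)) (x : W) :
    B y (W.proj (n, β) x : W) = B y x := by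
  refine W.isGrading.induction_on (p := fun x => B y (W.proj (n, β) x : W) = B y x) x ?_ ?_ ?_
  · intro j x hx
    by_cases hj : j = (n, β)
    · subst hj
      rw [show (W.proj (n, β) x : W) = x from W.isGrading.proj_of_mem hx]
    · rw [show W.proj (n, β) x = 0 from W.isGrading.proj_of_ne hx hj]
      symm
      simp only [ZeroMemClass.coe_zero, map_zero]
      refine D.graded (n, -β) j ?_ y hy _ hx
      by_contra h
      push Not at h
      exact hj (Prod.ext h.1.symm (neg_injective h.2).symm)
  · intro x x' hx hx'
    simp only [map_add, Submodule.coe_add, hx, hx']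
  · simp

include D in
theorem sep_grade {n : ℂ} {β : Γ} {x : W} (hx : x ∈ W.grade n β)
    (h : ∀ y ∈ N.grade n (-β), B y x = 0) : x = 0 := by
  refine D.sep x fun y => ?_
  refine N.isGrading.induction_on (p := fun y => B y x = 0) y ?_ ?_ ?_
  · intro i y hy
    by_cases hi : i = (n, -β)
    · subst hi
      exact h y hy
    · refine D.graded i (n, β) ?_ y hy x hx
      by_contra h
      push Not at h
      exact hi (Prod.ext h.1 h.2)
  · intro y y' hy hy'
    rw [map_add, LinearMap.add_apply, hy, hy', add_zero]
  · simp

include D in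
-- Sums in the completion are `finsum`s, which are zero by convention on infinite support. Since
-- homogeneous components are finite-dimensional, genuine finiteness can be checked after pairing.
theorem finite_of_sep {K : Type*} {n : ℂ} {β : Γ} (f : K → W.grade n β)
    (hf : ∀ y ∈ N.grade n (-β), (Function.support fun k => B y (f k : W)).Finite) :
    (Function.support f).Finite := by
  have := W.finite_dim n β
  refine finite_support_of_separating (P := N.grade n (-β))
    ((LinearMap.lcomp ℂ ℂ (W.grade n β).subtype) ∘ₗ B ∘ₗ (N.grade n (-β)).subtype) ?_ f ?_
  · intro x hx
    exact Subtype.ext (D.sep_grade x.2 fun y hy => hx ⟨y, hy⟩)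
  · intro y
    exact hf y y.2

theorem ext_pair {f g : W.Completion} (h : ∀ y, D.pair y f = D.pair y g) : f = g := by
  funext ⟨n, β⟩
  rw [← sub_eq_zero]
  refine Subtype.ext (D.sep_grade (f (n, β) - g (n, β)).2 fun y hy => ?_)
  rw [Submodule.coe_sub, map_sub, ← D.pair_of_mem hy f, ← D.pair_of_mem hy g, h y, sub_self]

theorem pair_induction {p : N → Prop} (y : N)
    (mem : ∀ (n : ℂ) (β : Γ), ∀ y ∈ N.grade n (-β), p y)
    (add : ∀ y y', p y → p y' → p (y + y')) (zero : p 0) : p y :=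
  N.isGrading.induction_on y
    (fun i y hy => mem i.1 (-i.2) y (by rwa [neg_neg])) add zero

/-- An operator with an adjoint extends honestly to the completion: `T' y` meets only finitely many
degrees, so only finitely many components of `f` contribute to any given degree. -/
theorem pair_ext {T : Module.End ℂ W} {T' : Module.End ℂ N}
    (hT : ∀ y x, B y (T x) = B (T' y) x) (y : N) (f : W.Completion) :
    D.pair y (W.ext T f) = D.pair (T' y) f := by
  refine pair_induction
    (p := fun y => D.pair y (W.ext T f) = D.pair (T' y) f) y ?_ ?_ ?_
  · intro n β y hy
    rw [D.pair_of_mem hy, GenModule.ext, D.pair_apply]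
    have hf : (Function.support fun k : ℂ × Γ => W.proj (n, β) (T (f k : W))).Finite := by
      refine D.finite_of_sep _ fun y hy => ?_
      simp only [D.apply_proj hy, hT]
      exact D.finite_support (T' y) f
    rw [← Submodule.subtype_apply, map_finsum _ hf,
      map_finsum (B y) (hf.subset fun k hk h0 => hk (by simp only [h0, map_zero]))]
    exact finsum_congr fun k => (D.apply_proj hy _).trans (hT _ _)
  · intro y y' hy hy'
    simp only [map_add, LinearMap.add_apply, hy, hy']
  · simp

variable (z : ℂ)

/-- Moves the left side of the Jacobi identity onto `N`: each mode has the opposite mode as adjoint,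
and `opp_powOp` resums them. -/
theorem pair_jacobi (p q : ℤ) (v : V) (y : N) (f : W.Completion) :
    D.pair y (fun i => ∑ᶠ k : ℕ, (binom p k * (-z) ^ k) • W.ext (W.Y (p + q - k) v) f i)
      = D.pair (𝒱.oppLin (N.powOp z p) q v y) f := by
  refine pair_induction (p := fun y =>
    D.pair y (fun i => ∑ᶠ k : ℕ, (binom p k * (-z) ^ k) • W.ext (W.Y (p + q - k) v) f i)
      = D.pair (𝒱.oppLin (N.powOp z p) q v y) f) y ?_ ?_ ?_
  · intro n β y hy
    have e : ∀ y ∈ N.grade n (-β), ∀ k : ℕ,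
        B y (((binom p k * (-z) ^ k) • W.ext (W.Y (p + q - k) v) f (n, β) :
          W.grade n β) : W) = D.pair ((binom p k * (-z) ^ k) • N.oppY (p + q - k) v y) f := by
      intro y hy k
      rw [Submodule.coe_smul, map_smul, ← D.pair_of_mem hy, D.pair_ext (D.adj_Y _ v), map_smul,
        LinearMap.smul_apply]
    have hf : (Function.support fun k : ℕ =>
        (binom p k * (-z) ^ k) • W.ext (W.Y (p + q - k) v) f (n, β)).Finite := by
      refine D.finite_of_sep _ fun y hy => ?_
      simp only [e y hy]
      exact (N.finite_oppY _ (p + q) v y).subset fun k hk h0 => hk (by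
        simp only [] at h0 ⊢
        rw [h0, map_zero, LinearMap.zero_apply])
    rw [D.pair_of_mem hy, ← Submodule.subtype_apply, map_finsum _ hf,
      map_finsum (B y) (hf.subset fun k hk h0 => hk (by simp only [h0, map_zero])),
      N.opp_powOp, ← LinearMap.flip_apply, map_finsum _ (N.finite_oppY _ (p + q) v y)]
    exact finsum_congr fun k => e y hy k
  · intro y y' hy hy'
    simp only [map_add, LinearMap.add_apply, hy, hy']
  · simp

variable {W₁ W₂ : GenModule.{u} 𝒱}

/-- The map `N → (W₁ ⊗ W₂)*` corresponding to a map `W₁ ⊗ W₂ → W̄`. -/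
noncomputable def transpose (I : (W₁ ⊗[ℂ] W₂) →ₗ[ℂ] W.Completion) :
    N →ₗ[ℂ] Module.Dual ℂ (W₁ ⊗[ℂ] W₂) :=
  LinearMap.lcomp ℂ ℂ I ∘ₗ D.pair

theorem transpose_apply (I : (W₁ ⊗[ℂ] W₂) →ₗ[ℂ] W.Completion) (y : N) (t : W₁ ⊗[ℂ] W₂) :
    D.transpose I y t = D.pair y (I t) := rfl

end IsDuality

/-- The conditions in `IsIncluded` other than injectivity. -/
structure IsDualMap (z : ℂ) (W₁ W₂ : GenModule.{u} 𝒱) {M : GenModule.{u} 𝒱}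
    (J : M →ₗ[ℂ] Module.Dual ℂ (W₁ ⊗[ℂ] W₂)) : Prop where
  grading_compat : ∀ β : Γ, ∀ x ∈ M.gammaGrade β, J x ∈ dualGamma W₁ W₂ β
  tau : ∀ (v : V) (p q : ℤ) (x : M), tauP z W₁ W₂ p q v (J x) = J (M.powOp z p q v x)
  sl2 : ∀ (j : SignType) (x : M), LP z W₁ W₂ j (J x) = J (M.L j x)

theorem IsIncluded.isDualMap {z : ℂ} {W₁ W₂ M : GenModule.{u} 𝒱}
    {J : M →ₗ[ℂ] Module.Dual ℂ (W₁ ⊗[ℂ] W₂)} (h : IsIncluded z W₁ W₂ J) :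
    IsDualMap z W₁ W₂ J :=
  ⟨h.grading_compat, h.tau, h.sl2⟩

/-- The right-hand side of the Jacobi identity for intertwining maps, as a function of `v`. -/
noncomputable def jacobiRight (z : ℂ) {W₁ W₂ : GenModule.{u} 𝒱} (x : W₁) (y : W₂) (p q : ℤ) :
    V →ₗ[ℂ] W₁ ⊗[ℂ] W₂ :=
  (TensorProduct.mk ℂ W₁ W₂).flip y ∘ₗ LinearMap.applyₗ x ∘ₗ W₁.shiftOpLin z p q
    + TensorProduct.mk ℂ W₁ W₂ x ∘ₗ LinearMap.applyₗ y ∘ₗ W₂.negOpLin z p q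

/-- Exhibits `τ_{P(z)}` as the opposite, in the index `q`, of the right side of the Jacobi identity
followed by `lam`. -/
theorem tauP_tmul (z : ℂ) (W₁ W₂ : GenModule.{u} 𝒱) (p q : ℤ) (v : V)
    (lam : Module.Dual ℂ (W₁ ⊗[ℂ] W₂)) (x : W₁) (y : W₂) :
    tauP z W₁ W₂ p q v lam (x ⊗ₜ y)
      = 𝒱.oppLin (fun k => lam ∘ₗ jacobiRight z x y p k) q v := by
  rw [← 𝒱.map_oppLin]
  unfold jacobiRight
  rw [𝒱.oppLin_add]
  have e₁ := 𝒱.map_oppLin ((TensorProduct.mk ℂ W₁ W₂).flip y ∘ₗ LinearMap.applyₗ x)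
    (W₁.shiftOpLin z p) q v
  have e₂ := 𝒱.map_oppLin (TensorProduct.mk ℂ W₁ W₂ x ∘ₗ LinearMap.applyₗ y)
    (W₂.negOpLin z p) q v
  simp only [LinearMap.comp_assoc] at e₁ e₂
  rw [← e₁, ← e₂]
  rfl

theorem LP_tmul (z : ℂ) (W₁ W₂ : GenModule.{u} 𝒱) (j : SignType)
    (lam : Module.Dual ℂ (W₁ ⊗[ℂ] W₂)) (x : W₁) (y : W₂) :
    LP z W₁ W₂ j lam (x ⊗ₜ y) = lam (x ⊗ₜ W₂.L (-j) y + W₁.shiftL z (-j) x ⊗ₜ y) := rfl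

/-! ### Transposing the Jacobi and `𝔰𝔩(2)` identities. -/

namespace IsDuality

variable {W N : GenModule.{u} 𝒱} {B : N →ₗ[ℂ] W →ₗ[ℂ] ℂ} (D : IsDuality W N B)
  (z : ℂ) {W₁ W₂ : GenModule.{u} 𝒱}

/-- With `p` and `x ⊗ y` fixed, let `X` be `v ↦ J(v · n)` evaluated at `x ⊗ y` and `Z` the right
side composed with `J n`, where `J` is the transpose of `I`. The first condition reads `opp X = Z`
(`h₁`), the second `opp Z = X` (`h₂`). -/
theorem jacobi_iff (I : (W₁ ⊗[ℂ] W₂) →ₗ[ℂ] W.Completion) :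
    (∀ (v : V) (x : W₁) (y : W₂) (p q : ℤ) (i : ℂ × Γ),
      (∑ᶠ k : ℕ, (binom p k * (-z) ^ k) • W.ext (W.Y (p + q - k) v) (I (x ⊗ₜ y)) i)
        = I ((W₁.shiftOp z p q v x) ⊗ₜ y) i + I (x ⊗ₜ (W₂.negOp z p q v y)) i) ↔
    ∀ (v : V) (p q : ℤ) (y : N), tauP z W₁ W₂ p q v (D.transpose I y)
      = D.transpose I (N.powOp z p q v y) := by
  have h₁ : ∀ x y p, ((∀ (q : ℤ) (v : V) (i : ℂ × Γ),
      (∑ᶠ k : ℕ, (binom p k * (-z) ^ k) • W.ext (W.Y (p + q - k) v) (I (x ⊗ₜ y)) i)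
        = I ((W₁.shiftOp z p q v x) ⊗ₜ y) i + I (x ⊗ₜ (W₂.negOp z p q v y)) i) ↔
      ∀ n : N, 𝒱.oppLin (fun k => LinearMap.applyₗ (x ⊗ₜ y) ∘ₗ D.transpose I ∘ₗ
        LinearMap.applyₗ n ∘ₗ N.powOp z p k)
        = fun k => D.transpose I n ∘ₗ jacobiRight z x y p k) := by
    intro x y p
    have e : ∀ n q v, 𝒱.oppLin (fun k => LinearMap.applyₗ (x ⊗ₜ y) ∘ₗ D.transpose I ∘ₗ
        LinearMap.applyₗ n ∘ₗ N.powOp z p k) q v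
        = D.pair n (fun i => ∑ᶠ k : ℕ,
          (binom p k * (-z) ^ k) • W.ext (W.Y (p + q - k) v) (I (x ⊗ₜ y)) i) := by
      intro n q v
      rw [D.pair_jacobi]
      exact (𝒱.map_oppLin (LinearMap.applyₗ (x ⊗ₜ y) ∘ₗ D.transpose I ∘ₗ
        LinearMap.applyₗ n) (N.powOp z p) q v).symm
    have e' : ∀ n q v, D.transpose I n (jacobiRight z x y p q v)
        = D.pair n (fun i => I ((W₁.shiftOp z p q v x) ⊗ₜ y) i
          + I (x ⊗ₜ (W₂.negOp z p q v y)) i) := by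
      intro n q v
      rw [transpose_apply]
      congr 1
      exact map_add I _ _
    constructor
    · intro h n
      ext q v
      rw [e, LinearMap.comp_apply, e']
      congr 1
      funext i
      exact h q v i
    · intro h q v i
      refine congrFun (D.ext_pair (f := fun i => ∑ᶠ k : ℕ,
        (binom p k * (-z) ^ k) • W.ext (W.Y (p + q - k) v) (I (x ⊗ₜ y)) i)
        (g := fun i => I ((W₁.shiftOp z p q v x) ⊗ₜ y) i
          + I (x ⊗ₜ (W₂.negOp z p q v y)) i) fun n => ?_) i
      rw [← e, ← e', h n]
      rfl
  have h₂ : ∀ x y p, ((∀ (q : ℤ) (v : V) (n : N),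
      tauP z W₁ W₂ p q v (D.transpose I n) (x ⊗ₜ y)
        = D.transpose I (N.powOp z p q v n) (x ⊗ₜ y)) ↔
      ∀ n : N, 𝒱.oppLin (fun k => D.transpose I n ∘ₗ jacobiRight z x y p k)
        = fun k => LinearMap.applyₗ (x ⊗ₜ y) ∘ₗ D.transpose I ∘ₗ
        LinearMap.applyₗ n ∘ₗ N.powOp z p k) := by
    intro x y p
    simp only [tauP_tmul]
    constructor
    · intro h n
      ext q v
      exact h q v n
    · intro h q v n
      rw [h n]
      rfl
  constructor
  · intro h v p q n
    refine TensorProduct.ext' fun x y => (h₂ x y p).2 (fun n => ?_) q v n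
    rw [← (h₁ x y p).1 (fun q v i => h v x y p q i) n, 𝒱.oppLin_oppLin]
  · intro h v x y p q i
    refine (h₁ x y p).2 (fun n => ?_) q v i
    rw [← (h₂ x y p).1 (fun q v n => by rw [h v p q n]) n, 𝒱.oppLin_oppLin]

theorem sl2_iff (I : (W₁ ⊗[ℂ] W₂) →ₗ[ℂ] W.Completion) :
    (∀ (j : SignType) (x : W₁) (y : W₂),
      W.ext (W.L j) (I (x ⊗ₜ y)) = I (x ⊗ₜ (W₂.L j y)) + I ((W₁.shiftL z j x) ⊗ₜ y)) ↔
    ∀ (j : SignType) (n : N), LP z W₁ W₂ j (D.transpose I n) = D.transpose I (N.L j n) := by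
  constructor
  · intro h j n
    refine TensorProduct.ext' fun x y => ?_
    rw [LP_tmul, transpose_apply, transpose_apply, map_add, ← h (-j), D.pair_ext (D.adj_L (-j)),
      neg_neg]
  · intro h j x y
    refine D.ext_pair fun n => ?_
    have := congrArg (fun l => l (x ⊗ₜ y)) (h (-j) n)
    simp only [LP_tmul, transpose_apply, neg_neg] at this
    rw [D.pair_ext (D.adj_L j), ← this, map_add]

end IsDuality

end Setting

/-- The cells other than `(a, b)` lie in the sum of the `G m`, `m ≠ a`, plus the part of `G a`
inside the sum of the `H m`, `m ≠ b`. Independence of `G` removes the first summand, then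
independence of `H` the second. -/
theorem iSupIndep_inf_prod {R M ι κ : Type*} [Ring R] [AddCommGroup M] [Module R M]
    {G : ι → Submodule R M} {H : κ → Submodule R M} (hG : iSupIndep G) (hH : iSupIndep H) :
    iSupIndep fun i : ι × κ => G i.1 ⊓ H i.2 := by
  rintro ⟨a, b⟩
  rw [Submodule.disjoint_def]
  rintro x ⟨hxG, hxH⟩ hx
  have hle : (⨆ (i : ι × κ) (_ : i ≠ (a, b)), G i.1 ⊓ H i.2)
      ≤ (⨆ (m) (_ : m ≠ a), G m) ⊔ (G a ⊓ ⨆ (m) (_ : m ≠ b), H m) := by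
    refine iSup₂_le fun i hi => ?_
    by_cases h : i.1 = a
    · refine le_sup_of_le_right (le_inf (h ▸ inf_le_left) (inf_le_right.trans ?_))
      exact le_iSup₂_of_le i.2 (fun e => hi (Prod.ext h e)) le_rfl
    · exact le_sup_of_le_left (inf_le_left.trans (le_iSup₂_of_le i.1 h le_rfl))
  obtain ⟨u, hu, w, ⟨hwG, hwH⟩, rfl⟩ := Submodule.mem_sup.1 (hle hx)
  have hu' : u ∈ G a := by simpa using sub_mem hxG hwG
  have h0 : u = 0 := Submodule.disjoint_def.1 (hG a) u hu' hu
  rw [h0, zero_add] at hxH ⊢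
  exact Submodule.disjoint_def.1 (hH b) w hxH hwH

section Setting

variable {Γ : Type w} [AddCommGroup Γ] {A : AddSubgroup Γ}
  {V : Type v} [AddCommGroup V] [Module ℂ V] {𝒱 : VertexAlgebra A V}

theorem mem_dualGamma {W₁ W₂ : GenModule.{u} 𝒱} {β : Γ}
    {lam : Module.Dual ℂ (W₁ ⊗[ℂ] W₂)} :
    lam ∈ dualGamma W₁ W₂ β ↔ ∀ β₁ β₂ : Γ, β₁ + β₂ ≠ -β → ∀ x ∈ W₁.gammaGrade β₁,
      ∀ y ∈ W₂.gammaGrade β₂, lam (x ⊗ₜ y) = 0 := by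
  simp only [dualGamma, Submodule.mem_iInf, Submodule.mem_dualAnnihilator]
  constructor
  · intro h β₁ β₂ hne x hx y hy
    exact h _ hne _ (Submodule.subset_span ⟨β₁, β₂, rfl, x, hx, y, hy, rfl⟩)
  · intro h γ hγ t ht
    have : tensorGrade W₁ W₂ γ ≤ LinearMap.ker lam := by
      refine Submodule.span_le.2 ?_
      rintro _ ⟨β₁, β₂, rfl, x, hx, y, hy, rfl⟩
      exact h β₁ β₂ hγ x hx y hy
    exact this ht

theorem GenModule.tensor_induction {W₁ W₂ : GenModule.{u} 𝒱} {p : W₁ ⊗[ℂ] W₂ → Prop}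
    (t : W₁ ⊗[ℂ] W₂)
    (mem : ∀ β₁ β₂ : Γ, ∀ x ∈ W₁.gammaGrade β₁, ∀ y ∈ W₂.gammaGrade β₂, p (x ⊗ₜ y))
    (add : ∀ s t, p s → p t → p (s + t)) (zero : p 0) : p t := by
  refine TensorProduct.induction_on t zero (fun x y => ?_) add
  refine W₁.isGrading.induction_on (p := fun x => p (x ⊗ₜ y)) x (fun i x hx => ?_) ?_ ?_
  · refine W₂.isGrading.induction_on (p := fun y => p (x ⊗ₜ y)) y (fun j y hy => ?_) ?_ ?_
    · exact mem i.2 j.2 x (Submodule.mem_iSup_of_mem i.1 hx) y (Submodule.mem_iSup_of_mem j.1 hy)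
    · intro y y' hy hy'
      rw [TensorProduct.tmul_add]
      exact add _ _ hy hy'
    · rwa [TensorProduct.tmul_zero]
  · intro x x' hx hx'
    rw [TensorProduct.add_tmul]
    exact add _ _ hx hx'
  · rwa [TensorProduct.zero_tmul]

/-! ### Intertwining maps correspond to maps into `(W₁ ⊗ W₂)*`. -/

namespace IsDuality

variable {W N : GenModule.{u} 𝒱} {B : N →ₗ[ℂ] W →ₗ[ℂ] ℂ} (D : IsDuality W N B)
  {z : ℂ} {W₁ W₂ : GenModule.{u} 𝒱} {I : (W₁ ⊗[ℂ] W₂) →ₗ[ℂ] W.Completion}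

theorem isDualMap_transpose (hI : IsIntertwiningMap z I) :
    IsDualMap z W₁ W₂ (D.transpose I) where
  grading_compat β n hn := by
    rw [mem_dualGamma]
    intro β₁ β₂ hne x hx y hy
    refine Submodule.iSup_induction (fun m => N.grade m β)
      (motive := fun n => D.transpose I n (x ⊗ₜ y) = 0) hn ?_ ?_ ?_
    · intro m n hn
      rw [transpose_apply, D.pair_of_mem (n := m) (β := -β) (by rwa [neg_neg]),
        hI.grading_compat β₁ β₂ x hx y hy _ (Ne.symm hne)]
      simp
    · simp
    · intro n n' h h'
      rw [map_add, LinearMap.add_apply, h, h', add_zero]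
  tau := (D.jacobi_iff z I).1 hI.jacobi
  sl2 := (D.sl2_iff z I).1 hI.sl2

theorem isIntertwiningMap (hJ : IsDualMap z W₁ W₂ (D.transpose I)) :
    IsIntertwiningMap z I := by
  have hg : ∀ (β γ : Γ), ∀ x ∈ W₁.gammaGrade β, ∀ y ∈ W₂.gammaGrade γ,
      ∀ i : ℂ × Γ, i.2 ≠ β + γ → I (x ⊗ₜ y) i = 0 := by
    intro β γ x hx y hy i hi
    refine Subtype.ext (D.sep_grade (I (x ⊗ₜ y) i).2 fun n hn => ?_)
    rw [← D.pair_of_mem hn, ← transpose_apply]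
    refine mem_dualGamma.1 (hJ.grading_compat (-i.2) n (Submodule.mem_iSup_of_mem i.1 hn))
      β γ ?_ x hx y hy
    rw [neg_neg]
    exact hi.symm
  refine ⟨hg, ?_, (D.jacobi_iff z I).2 hJ.tau, (D.sl2_iff z I).2 hJ.sl2⟩
  intro x y n
  refine GenModule.tensor_induction
    (p := fun t => ∃ K : ℕ, ∀ k : ℕ, K ≤ k → ∀ β : Γ, I t (n - k, β) = 0) (x ⊗ₜ y) ?_ ?_ ?_
  · intro β₁ β₂ x hx y hy
    -- Lower truncation of `I` comes from the grading restriction on `N`: the component of weight `n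
    -- - k` is detected by `N` in weight `n - k` and degree `-(β₁ + β₂)`, which vanishes for large
    -- `k`.
    obtain ⟨K, hK⟩ := N.grading_restriction n (-(β₁ + β₂))
    refine ⟨(-K).toNat, fun k hk β => ?_⟩
    by_cases hβ : β = β₁ + β₂
    · subst hβ
      refine Subtype.ext (D.sep_grade (I (x ⊗ₜ y) (n - k, β₁ + β₂)).2 fun m hm => ?_)
      have h := hK (-k) (by omega)
      push_cast at h
      rw [← sub_eq_add_neg] at h
      rw [h, Submodule.mem_bot] at hm
      simp [hm]
    · exact hg β₁ β₂ x hx y hy _ hβ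
  · rintro s t ⟨K, hK⟩ ⟨K', hK'⟩
    refine ⟨max K K', fun k hk β => ?_⟩
    rw [map_add, Pi.add_apply, hK k (le_of_max_le_left hk) β, hK' k (le_of_max_le_right hk) β,
      add_zero]
  · exact ⟨0, fun k _ β => by simp⟩

end IsDuality

/-- Since `N` in degree `(n, β)` is the dual of `M` in degree `(n, -β)`, the component of `I t`
there is forced: it is `m ↦ J m t` on that piece of `M`. Each `B m` lies in the graded dual of `N`,
so vectors of `M` serve as the `w'` in `backslash`. -/
theorem IsContragredient.exists_transpose_eq {M N : GenModule.{u} 𝒱} (h : IsContragredient M N)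
    {W₁ W₂ : GenModule.{u} 𝒱} (J : M →ₗ[ℂ] Module.Dual ℂ (W₁ ⊗[ℂ] W₂)) :
    ∃ (B : M →ₗ[ℂ] N →ₗ[ℂ] ℂ) (D : IsDuality N M B)
      (I : (W₁ ⊗[ℂ] W₂) →ₗ[ℂ] N.Completion),
      (∀ m, (B m ∈ N.gradedDual)) ∧ D.transpose I = J := by
  obtain ⟨χ, hY, hL, hg⟩ := h
  let B : M →ₗ[ℂ] N →ₗ[ℂ] ℂ := (M.gradedDual.subtype ∘ₗ χ.toLinearMap).flip
  have hB : ∀ m n, B m n = (χ n : Module.Dual ℂ M) m := fun _ _ => rfl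
  have D : IsDuality N M B := by
    refine ⟨?_, ?_, ?_, ?_⟩
    · intro i j hij m hm n hn
      refine (hg _ _ n).1 hn i.1 i.2 (fun e => ?_) m hm
      simp only [Prod.mk.injEq] at e
      exact hij.elim (fun h => h e.1) fun h => h e.2
    · intro n hn
      rw [← χ.map_eq_zero_iff]
      exact Subtype.ext (LinearMap.ext hn)
    · intro n v m x
      exact hY n v x m
    · intro j m n
      exact hL j n m
  have hmem : ∀ (t : W₁ ⊗[ℂ] W₂) (i : ℂ × Γ),
      J.flip t ∘ₗ (M.grade i.1 (-i.2)).subtype ∘ₗ M.proj (i.1, -i.2) ∈ M.dualGrade i.1 i.2 := by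
    intro t i m γ hne x hx
    have : M.proj (i.1, -i.2) x = 0 := M.isGrading.proj_of_ne (i := (m, γ)) hx hne
    simp [this]
  let F : (W₁ ⊗[ℂ] W₂) →ₗ[ℂ] (i : ℂ × Γ) → M.gradedDual :=
    LinearMap.pi fun i =>
      (LinearMap.lcomp ℂ ℂ ((M.grade i.1 (-i.2)).subtype ∘ₗ M.proj (i.1, -i.2))
        ∘ₗ J.flip).codRestrict M.gradedDual fun t => Submodule.mem_iSup_of_mem i (hmem t i)
  have hF : ∀ t i, χ.symm (F t i) ∈ N.grade i.1 i.2 := by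
    intro t i
    rw [hg, LinearEquiv.apply_symm_apply]
    exact hmem t i
  let I : (W₁ ⊗[ℂ] W₂) →ₗ[ℂ] N.Completion :=
    LinearMap.pi fun i => (χ.symm.toLinearMap ∘ₗ LinearMap.proj i ∘ₗ F).codRestrict
      (N.grade i.1 i.2) fun t => hF t i
  refine ⟨B, D, I, ?_, ?_⟩
  · intro m
    refine M.isGrading.induction_on (p := fun m => B m ∈ N.gradedDual) m ?_ ?_ ?_
    · intro i m hm
      refine Submodule.mem_iSup_of_mem i fun k γ hne n hn => D.graded i (k, γ) ?_ m hm n hn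
      by_contra h
      push Not at h
      exact hne (Prod.ext h.1.symm (by simp [h.2]))
    · intro m m' h h'
      rw [map_add]
      exact add_mem h h'
    · rw [map_zero]
      exact zero_mem _
  · refine LinearMap.ext fun m => LinearMap.ext fun t => ?_
    refine IsDuality.pair_induction (p := fun m => D.transpose I m t = J m t) m ?_ ?_ ?_
    · intro n β m hm
      rw [D.transpose_apply, D.pair_of_mem hm, hB]
      change (χ (χ.symm (F t (n, β))) : Module.Dual ℂ M) m = _
      rw [LinearEquiv.apply_symm_apply]
      change J (M.proj (n, -β) m : M) t = _
      rw [show (M.proj (n, -β) m : M) = m from M.isGrading.proj_of_mem hm]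
    · intro m m' h h'
      rw [map_add, map_add, LinearMap.add_apply, LinearMap.add_apply, h, h']
    · simp

/-! ### Functionals in the image of a generalized module -/

section Image

variable {z : ℂ} {W₁ W₂ : GenModule.{u} 𝒱}

/-- Homogeneous tensors decide: those of degree `-β` are killed by every other `dualGamma γ`, the
rest by `dualGamma β` itself. -/
theorem iSupIndep_dualGamma : iSupIndep (dualGamma W₁ W₂) := by
  intro β
  rw [Submodule.disjoint_def]
  intro lam hl hs
  refine LinearMap.ext fun t => ?_
  refine GenModule.tensor_induction (p := fun t => lam t = 0) t ?_ ?_ ?_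
  · intro β₁ β₂ x hx y hy
    by_cases h : β₁ + β₂ = -β
    · have hle : (⨆ (γ) (_ : γ ≠ β), dualGamma W₁ W₂ γ) ≤
          (ℂ ∙ (x ⊗ₜ[ℂ] y)).dualAnnihilator := by
        refine iSup₂_le fun γ hγ μ hμ => ?_
        rw [Submodule.mem_dualAnnihilator]
        intro t ht
        obtain ⟨c, rfl⟩ := Submodule.mem_span_singleton.1 ht
        rw [map_smul, mem_dualGamma.1 hμ β₁ β₂ (fun e => hγ (neg_injective (e.symm.trans h))) x hx y hy,
          smul_zero]
      exact (Submodule.mem_dualAnnihilator _).1 (hle hs) _ (Submodule.mem_span_singleton_self _)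
    · exact mem_dualGamma.1 hl β₁ β₂ h x hx y hy
  · intro s t hs ht
    rw [map_add, hs, ht, add_zero]
  · simp

theorem iSupIndep_dualGen :
    iSupIndep fun i : ℂ × Γ => dualGen z W₁ W₂ i.1 i.2 :=
  iSupIndep_inf_prod (Module.End.independent_maxGenEigenspace _) iSupIndep_dualGamma

namespace IsDualMap

variable {N : GenModule.{u} 𝒱} {J : N →ₗ[ℂ] Module.Dual ℂ (W₁ ⊗[ℂ] W₂)}
  (hJ : IsDualMap z W₁ W₂ J)

include hJ

theorem YP_apply (n : ℤ) (v : V) (y : N) : YP z W₁ W₂ n v (J y) = J (N.Y n v y) := by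
  -- For `p = 0` the binomial series reduces to its constant term.
  rw [YP, hJ.tau, N.powOp_apply, finsum_eq_single _ 0]
  · simp [binom]
  · intro i hi
    simp [binom, Ring.choose_zero_pos ℤ (Nat.pos_of_ne_zero hi)]

theorem mem_COMP (y : N) : J y ∈ COMP z W₁ W₂ := by
  constructor
  · intro v
    obtain ⟨K, hK⟩ := N.action.truncation v y
    exact ⟨K, fun n hn => by rw [hJ.YP_apply, hK n hn, map_zero]⟩
  · intro v p q
    rw [hJ.tau, N.powOp_apply, map_finsum J (N.finite_powOp z p q v y)]
    simp only [hJ.YP_apply, map_smul]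

theorem mem_dualGen {n : ℂ} {β : Γ} {y : N} (hy : y ∈ N.grade n β) :
    J y ∈ dualGen z W₁ W₂ n β := by
  refine ⟨?_, hJ.grading_compat β y (Submodule.mem_iSup_of_mem n hy)⟩
  obtain ⟨m, hm⟩ := N.L_zero n β y hy
  refine (Module.End.mem_maxGenEigenspace _ _ _).2 ⟨m, ?_⟩
  have h : ∀ (k : ℕ) (x : N), ((LP z W₁ W₂ 0 - n • (1 : Module.End ℂ (Module.Dual ℂ (W₁ ⊗[ℂ] W₂)))) ^ k)
      (J x)
      = J (((N.L 0 - n • (1 : Module.End ℂ N)) ^ k) x) := by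
    intro k
    induction k with
    | zero => simp
    | succ k ih =>
      intro x
      rw [pow_succ, pow_succ, Module.End.mul_apply, Module.End.mul_apply, ← ih]
      simp [hJ.sl2]
  rw [h, hm, map_zero]

theorem mem_dualOrd (hN : N.IsOrdinary) {n : ℂ} {β : Γ} {y : N} (hy : y ∈ N.grade n β) :
    J y ∈ dualOrd z W₁ W₂ n β := by
  refine ⟨?_, hJ.grading_compat β y (Submodule.mem_iSup_of_mem n hy)⟩
  refine Module.End.mem_eigenspace_iff.2 ?_
  rw [hJ.sl2, hN n β y hy, map_smul]

omit hJ in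
theorem mem_iSup {S : ℂ × Γ → Submodule ℂ (Module.Dual ℂ (W₁ ⊗[ℂ] W₂))}
    (h : ∀ i : ℂ × Γ, ∀ y ∈ N.grade i.1 i.2, J y ∈ S i) (y : N) : J y ∈ ⨆ i, S i := by
  refine N.isGrading.induction_on (p := fun y => J y ∈ ⨆ i, S i) y ?_ ?_ ?_
  · intro i y hy
    exact Submodule.mem_iSup_of_mem i (h i y hy)
  · intro y y' h h'
    rw [map_add]
    exact add_mem h h'
  · rw [map_zero]
    exact zero_mem _

/-- The range of `J` competes in the infimum defining `Wgen`. -/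
theorem Wgen_le (y : N) : Wgen z W₁ W₂ (J y) ≤ LinearMap.range J := by
  refine sInf_le ⟨?_, ⟨y, rfl⟩, ?_, ?_⟩
  · refine le_antisymm ?_ (iSup_le fun i => inf_le_left)
    rintro _ ⟨x, rfl⟩
    exact mem_iSup (S := fun i => LinearMap.range J ⊓ dualGen z W₁ W₂ i.1 i.2)
      (fun i y hy => ⟨⟨y, rfl⟩, hJ.mem_dualGen hy⟩) x
  · rintro m v _ ⟨x, rfl⟩
    exact ⟨N.Y m v x, (hJ.YP_apply m v x).symm⟩
  · rintro j _ ⟨x, rfl⟩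
    exact ⟨N.L j x, (hJ.sl2 j x).symm⟩

/-- Injectivity of `J` is not available. Instead, `J` of the difference between `y` and its `(n, β)`
component lies both in `dualGen n β` and in the sum of the other `dualGen`s, hence is zero. -/
theorem range_inf_dualGen_le (n : ℂ) (β : Γ) :
    LinearMap.range J ⊓ dualGen z W₁ W₂ n β ≤ (N.grade n β).map J := by
  rintro _ ⟨⟨y, rfl⟩, hy⟩
  refine ⟨N.proj (n, β) y, (N.proj (n, β) y).2, ?_⟩
  have h : y - N.proj (n, β) y ∈ ⨆ (i : ℂ × Γ) (_ : i ≠ (n, β)), N.grade i.1 i.2 := by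
    refine N.isGrading.induction_on (p := fun y => y - N.proj (n, β) y ∈
      ⨆ (i : ℂ × Γ) (_ : i ≠ (n, β)), N.grade i.1 i.2) y ?_ ?_ ?_
    · intro i y hy
      by_cases hi : i = (n, β)
      · subst hi
        rw [show (N.proj (n, β) y : N) = y from N.isGrading.proj_of_mem hy, sub_self]
        exact zero_mem _
      · rw [show N.proj (n, β) y = 0 from N.isGrading.proj_of_ne hy hi]
        rw [ZeroMemClass.coe_zero, sub_zero]
        exact Submodule.mem_iSup_of_mem i (Submodule.mem_iSup_of_mem hi hy)
    · intro y y' h h'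
      rw [map_add, Submodule.coe_add, add_sub_add_comm]
      exact add_mem h h'
    · simp
  have h' : J (y - N.proj (n, β) y) ∈
      ⨆ (i : ℂ × Γ) (_ : i ≠ (n, β)), dualGen z W₁ W₂ i.1 i.2 := by
    refine (?_ : Submodule.map J (⨆ (i : ℂ × Γ) (_ : i ≠ (n, β)), N.grade i.1 i.2) ≤ _)
      (Submodule.mem_map_of_mem h)
    simp only [Submodule.map_iSup]
    refine iSup₂_mono fun i _ => ?_
    rintro _ ⟨x, hx, rfl⟩
    exact hJ.mem_dualGen hx
  have h0 := (Submodule.disjoint_def.1 (iSupIndep_dualGen (z := z) (n, β))) _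
    (by rw [map_sub]; exact sub_mem hy (hJ.mem_dualGen (N.proj (n, β) y).2)) h'
  rw [map_sub, sub_eq_zero] at h0
  exact h0.symm

theorem Wgen_inf_le (y : N) (n : ℂ) (β : Γ) :
    Wgen z W₁ W₂ (J y) ⊓ dualGen z W₁ W₂ n β ≤ (N.grade n β).map J :=
  (inf_le_inf_right _ (hJ.Wgen_le y)).trans (hJ.range_inf_dualGen_le n β)

theorem mem_LGRgen (y : N) : J y ∈ LGRgen z W₁ W₂ := by
  refine ⟨mem_iSup (fun i y hy => hJ.mem_dualGen hy) y, fun n β => ?_, fun n β => ?_⟩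
  · have := N.finite_dim n β
    exact Submodule.finiteDimensional_of_le (hJ.Wgen_inf_le y n β)
  · obtain ⟨K, hK⟩ := N.grading_restriction n β
    refine ⟨K, fun k hk => ?_⟩
    have := hJ.Wgen_inf_le y (n + k) β
    rwa [hK k hk, Submodule.map_bot, le_bot_iff] at this

omit hJ in
theorem dualOrd_le (n : ℂ) (β : Γ) : dualOrd z W₁ W₂ n β ≤ dualGen z W₁ W₂ n β :=
  inf_le_inf_right _ ((LP z W₁ W₂ 0).genEigenspace_le_maximal n 1)

/-- Semisimplicity of `L(0)` matters only for membership in the sum of eigenspaces; finiteness and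
truncation pass from generalized eigenspaces to the smaller eigenspaces. -/
theorem mem_LGRord (hN : N.IsOrdinary) (y : N) : J y ∈ LGRord z W₁ W₂ := by
  have h := hJ.mem_LGRgen y
  refine ⟨mem_iSup (fun i y hy => hJ.mem_dualOrd hN hy) y, fun n β => ?_, fun n β => ?_⟩
  · have := h.finite_dim n β
    exact Submodule.finiteDimensional_of_le (inf_le_inf_left _ (dualOrd_le n β))
  · obtain ⟨K, hK⟩ := h.truncation n β
    exact ⟨K, fun k hk => le_bot_iff.1 ((inf_le_inf_left _ (dualOrd_le _ β)).trans (hK k hk).le)⟩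

end IsDualMap

/-! ### Passing between `backslash` and maps from objects of `C`. -/

variable {C : GenModule.{u} 𝒱 → Prop}

theorem mem_Wgen (lam : Module.Dual ℂ (W₁ ⊗[ℂ] W₂)) : lam ∈ Wgen z W₁ W₂ lam := by
  rw [Wgen, Submodule.mem_sInf]
  exact fun S hS => hS.mem

theorem exists_isDualMap_of_mem_backslash (hdual : ClosedUnderContragredients C)
    {lam : Module.Dual ℂ (W₁ ⊗[ℂ] W₂)} (h : lam ∈ backslash C z W₁ W₂) :
    ∃ N, C N ∧ ∃ (J : N →ₗ[ℂ] Module.Dual ℂ (W₁ ⊗[ℂ] W₂)) (y : N),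
      IsDualMap z W₁ W₂ J ∧ J y = lam := by
  obtain ⟨W, hW, I, hI, w', hlam⟩ := h
  obtain ⟨N, hN, hc⟩ := hdual W hW
  obtain ⟨φ, D⟩ := hc.exists_isDuality
  refine ⟨N, hN, D.transpose I, φ.symm w', D.isDualMap_transpose hI, ?_⟩
  refine LinearMap.ext fun t => ?_
  rw [hlam, D.transpose_apply, D.pair_apply]
  simp [GenModule.pairing]

theorem mem_backslash (hdual : ClosedUnderContragredients C)
    {lam : Module.Dual ℂ (W₁ ⊗[ℂ] W₂)} (h : LiesInObject z W₁ W₂ C lam) :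
    lam ∈ backslash C z W₁ W₂ := by
  obtain ⟨M, hM, J, hJ, hle⟩ := h
  -- Only `lam ∈ W_lam` is needed from the containment.
  obtain ⟨m, rfl⟩ := hle (mem_Wgen lam)
  obtain ⟨N, hN, hc⟩ := hdual M hM
  obtain ⟨B, D, I, hB, hIJ⟩ := hc.exists_transpose_eq J
  refine ⟨N, hN, I, D.isIntertwiningMap (hIJ ▸ hJ.isDualMap), ⟨B m, hB m⟩, fun t => ?_⟩
  rw [← hIJ]
  rfl

end Image

end Setting

end HLZ

theorem mainTheorem3 {Γ : Type w} [AddCommGroup Γ] {A : AddSubgroup Γ}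
    {V : Type v} [AddCommGroup V] [Module ℂ V] (𝒱 : HLZ.VertexAlgebra A V)
    (z : ℂ) (hz : z ≠ 0)
    (C : HLZ.GenModule.{u} 𝒱 → Prop)
    (hdual : HLZ.ClosedUnderContragredients C) (hsum : HLZ.ClosedUnderDirectSums C)
    (W₁ W₂ : HLZ.GenModule.{u} 𝒱) (h₁ : C W₁) (h₂ : C W₂) :
    ((∀ lam ∈ HLZ.COMP z W₁ W₂ ∩ HLZ.LGRgen z W₁ W₂, HLZ.LiesInObject z W₁ W₂ C lam) →
      HLZ.backslash C z W₁ W₂ = HLZ.COMP z W₁ W₂ ∩ HLZ.LGRgen z W₁ W₂) ∧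
    ((∀ W, C W → W.IsOrdinary) →
      (∀ lam ∈ HLZ.COMP z W₁ W₂ ∩ HLZ.LGRord z W₁ W₂, HLZ.LiesInObject z W₁ W₂ C lam) →
      HLZ.backslash C z W₁ W₂ = HLZ.COMP z W₁ W₂ ∩ HLZ.LGRord z W₁ W₂) := by
  refine ⟨fun h => Set.Subset.antisymm ?_ ?_, fun hord h => Set.Subset.antisymm ?_ ?_⟩
  · intro lam hlam
    obtain ⟨N, -, J, y, hJ, rfl⟩ := HLZ.exists_isDualMap_of_mem_backslash hdual hlam
    exact ⟨hJ.mem_COMP y, hJ.mem_LGRgen y⟩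
  · exact fun lam hlam => HLZ.mem_backslash hdual (h lam hlam)
  · intro lam hlam
    obtain ⟨N, hN, J, y, hJ, rfl⟩ := HLZ.exists_isDualMap_of_mem_backslash hdual hlam
    exact ⟨hJ.mem_COMP y, hJ.mem_LGRord (hord N hN) y⟩
  · exact fun lam hlam => HLZ.mem_backslash hdual (h lam hlam)
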